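/- Let $\kappa:\mathbb R\to\mathbb R$ be a measurable dispersion law with $\kappa(\omega)>0$ for $\omega>0$ (for deep water, $\kappa(\omega)=\omega^2/g$), and let $S(\omega,\theta)\ge 0$, $\omega>0$, $\theta\in[0,2\pi]$, be an integrable directional spectral density that is not almost everywhere zero, with spectral moments $$\lambda_{ij}=\int_0^\infty\!\!\int_0^{2\pi}(\kappa(\omega)\cos\theta)^i\,\omega^j\,S(\omega,\theta)\,d\theta\,d\omega .$$ Let $W(x,t)$, $(x,t)\in\mathbb R^2$, be a zero mean stationary Gaussian field with a.s. continuously differentiable sample paths and covariance function $$\mathbb E[W(x,t)W(x+\xi,t+\tau)]=\int_0^\infty\!\!\int_0^{2\pi}\cos(\omega\tau+\kappa(\omega)\xi\cos\theta)\,S(\omega,\theta)\,d\theta\,d\omega .$$ Let $v\in\mathbb R$ be the velocity of a ship, let $Z(t)=W(vt,t)$ be the encountered sea, and let $$F^{\mathrm{enc}}_{W_x}(w)=\frac{\mathbb E[\#\{t\in[0,1]: Z(t)=0,\ Z_t(t)>0,\ W_x(vt,t)<0,\ W_x(vt,t)\le w\}]}{\mathbb E[\#\{t\in[0,1]: Z(t)=0,\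 Z_t(t)>0,\ W_x(vt,t)<0\}]}$$ be the Palm distribution function of the slope at wave centres overtaking the ship. Then $\lambda_{20},\lambda_{11},\lambda_{02}$ are finite, $\lambda_{20}\lambda_{02}>\lambda_{11}^2$, and the denominator of $F^{\mathrm{enc}}_{W_x}$ is positive and finite. The vector $(Z(0),Z_t(0),W_x(0,0))$ has a continuous joint density $f$, and for all $w\in\mathbb R$ $$F^{\mathrm{enc}}_{W_x}(w)=\frac{\mathbb E[Z_t(0)^+\mathbf 1_{\{W_x(0,0)<0,\,W_x(0,0)\le w\}}\mid Z(0)=0]\,f_{Z(0)}(0)}{\mathbb E[Z_t(0)^+\mathbf 1_{\{W_x(0,0)<0\}}\mid Z(0)=0]\,f_{Z(0)}(0)},$$ with $x^+=\max(x,0)$, where $\mathbb E[Z_t(0)^+\mathbf 1_{\{W_x(0,0)\in B\}}\mid Z(0)=0]\,f_{Z(0)}(0)$ stands for the integral $\int\!\!\int z^+\mathbf 1_{\{y\in B\}}f(0,z,y)\,dz\,dy$; both integrals are finite and the one in the denominator is positive. Moreover, $F^{\mathrm{enc}}_{W_x}(w)=1$ for $w\ge 0$, and for $w<0$ $$F^{\mathrm{enc}}_{W_x}(w)=\frac{2}{1-\rho}\left(\Phi\!\left(\frac{w}{\sqrt{\lambda_{20}(1-\rho^2)}}\right)-\rho\,e^{-w^2/(2\lambda_{20})}\,\Phi\!\left(\frac{\rho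 w}{\sqrt{\lambda_{20}(1-\rho^2)}}\right)\right),$$ where $\Phi$ is the standard normal distribution function and $$\rho=\frac{v\lambda_{20}+\lambda_{11}}{\sqrt{\lambda_{20}(v^2\lambda_{20}+2v\lambda_{11}+\lambda_{02})}} .$$ -/

import Mathlib

open MeasureTheory ProbabilityTheory Set
open scoped ENNReal

noncomputable section

namespace EncounteredSea

variable {Ω : Type*}

/-! ### The spectrum -/

/-- Range of (angular frequency, wave direction): `ω > 0` and `θ ∈ [0, 2π]`. -/
def spectralDomain : Set (ℝ × ℝ) := Ioi 0 ×ˢ Icc 0 (2 * Real.pi)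

/-- A directional spectral density: nonnegative and integrable (with respect to `dω dθ`). -/
structure IsSpectralDensity (S : ℝ × ℝ → ℝ) : Prop where
  nonneg : ∀ p ∈ spectralDomain, 0 ≤ S p
  integrable : IntegrableOn S spectralDomain

/-- A dispersion law `ω ↦ κ(ω)`, giving the (positive) wave number of a wave with angular
frequency `ω > 0`. The deep water law is `κ(ω) = ω ^ 2 / g`. -/
structure IsDispersionLaw (κ : ℝ → ℝ) : Prop where
  measurable : Measurable κ
  pos : ∀ ω, 0 < ω → 0 < κ ω

/-- The integrand `(κ(ω) cos θ)^i ω^j S(ω, θ)` of the spectral moment `λ_ij`. -/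
def momentIntegrand (κ : ℝ → ℝ) (S : ℝ × ℝ → ℝ) (i j : ℕ) (p : ℝ × ℝ) : ℝ :=
  (κ p.1 * Real.cos p.2) ^ i * p.1 ^ j * S p

/-- The spectral moment `λ_ij = ∫ ∫ (κ(ω) cos θ)^i ω^j S(ω, θ) dθ dω`. -/
def spectralMoment (κ : ℝ → ℝ) (S : ℝ × ℝ → ℝ) (i j : ℕ) : ℝ :=
  ∫ p in spectralDomain, momentIntegrand κ S i j p

/-- The covariance function
`R(ξ, τ) = ∫ ∫ cos (ω τ + κ(ω) ξ cos θ) S(ω, θ) dθ dω`. -/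
def covarianceFunction (κ : ℝ → ℝ) (S : ℝ × ℝ → ℝ) (ξ τ : ℝ) : ℝ :=
  ∫ p in spectralDomain, Real.cos (p.1 * τ + κ p.1 * ξ * Real.cos p.2) * S p

/-! ### The sea surface -/

/-- `W (x, t)` is a zero mean Gaussian field with directional spectral density `S` and a.s.
continuously differentiable sample paths. The covariance of `W (x, t)` and `W (x + ξ, t + τ)`
does not depend on `(x, t)`, so (being Gaussian with mean zero) the field is stationary. -/
structure IsGaussianSea [MeasurableSpace Ω] (μ : Measure Ω) (κ : ℝ → ℝ) (S : ℝ × ℝ → ℝ)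
    (W : ℝ × ℝ → Ω → ℝ) : Prop where
  gaussian : IsGaussianProcess W μ
  mean_zero : ∀ p, ∫ o, W p o ∂μ = 0
  covariance : ∀ x t ξ τ : ℝ,
    ∫ o, W (x, t) o * W (x + ξ, t + τ) o ∂μ = covarianceFunction κ S ξ τ
  contDiff : ∀ᵐ o ∂μ, ContDiff ℝ 1 (fun p : ℝ × ℝ => W p o)

/-- The slope `W_x (x, t)`. -/
def slope (W : ℝ × ℝ → Ω → ℝ) (x t : ℝ) (o : Ω) : ℝ :=
  deriv (fun y => W (y, t) o) x

/-- The encountered sea `Z(t) = W(v t, t)`, for a ship with velocity `v`. -/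
def encountered (W : ℝ × ℝ → Ω → ℝ) (v t : ℝ) (o : Ω) : ℝ :=
  W (v * t, t) o

/-- The derivative `Z_t(t)` of the encountered sea. -/
def encounteredDeriv (W : ℝ × ℝ → Ω → ℝ) (v t : ℝ) (o : Ω) : ℝ :=
  deriv (fun s => encountered W v s o) t

/-! ### The Palm distribution of the slope at overtaking wave centres -/

/-- The times `t ∈ [0, 1]` at which the ship is overtaken by a wave centre: `Z(t) = 0`,
`Z_t(t) > 0` and `W_x(v t, t) < 0`. -/
def overtakingTimes (W : ℝ × ℝ → Ω → ℝ) (v : ℝ) (o : Ω) : Set ℝ :=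
  {t | t ∈ Icc (0 : ℝ) 1 ∧ encountered W v t o = 0 ∧ 0 < encounteredDeriv W v t o ∧
    slope W (v * t) t o < 0}

/-- The expected number of overtaking times in `[0, 1]`. -/
def expectedOvertakings [MeasurableSpace Ω] (μ : Measure Ω) (W : ℝ × ℝ → Ω → ℝ) (v : ℝ) :
    ℝ≥0∞ :=
  ∫⁻ o, ((overtakingTimes W v o).encard : ℝ≥0∞) ∂μ

/-- The expected number of overtaking times in `[0, 1]` at which the slope is at most `w`. -/
def expectedOvertakingsLE [MeasurableSpace Ω] (μ : Measure Ω) (W : ℝ × ℝ → Ω → ℝ) (v w : ℝ) :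
    ℝ≥0∞ :=
  ∫⁻ o, ({t | t ∈ overtakingTimes W v o ∧ slope W (v * t) t o ≤ w}.encard : ℝ≥0∞) ∂μ

/-- The Palm distribution function `F_{W_x}^{enc}(w)` of the slope at overtaking wave centres. -/
def encSlopeCDF [MeasurableSpace Ω] (μ : Measure Ω) (W : ℝ × ℝ → Ω → ℝ) (v w : ℝ) : ℝ :=
  (expectedOvertakingsLE μ W v w / expectedOvertakings μ W v).toReal

/-! ### Rice type integrals -/

/-- `f` is the continuous version of the joint density of `(Z(0), Z_t(0), W_x(0, 0))`
(such a version is unique). -/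
structure IsJointDensity [MeasurableSpace Ω] (μ : Measure Ω) (W : ℝ × ℝ → Ω → ℝ) (v : ℝ)
    (f : ℝ × ℝ × ℝ → ℝ) : Prop where
  continuous : Continuous f
  nonneg : ∀ q, 0 ≤ f q
  map_eq : μ.map (fun o => (encountered W v 0 o, encounteredDeriv W v 0 o, slope W 0 0 o))
    = volume.withDensity (fun q => ENNReal.ofReal (f q))

open Classical in
/-- The integrand `z⁺ 1_{E(y)} f(0, z, y)`. -/
def riceIntegrand (f : ℝ × ℝ × ℝ → ℝ) (E : ℝ → Prop) (q : ℝ × ℝ) : ℝ :=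
  max q.1 0 * (if E q.2 then 1 else 0) * f (0, q.1, q.2)

/-- `E[Z_t(0)⁺ 1_{E(W_x(0, 0))} | Z(0) = 0] f_{Z(0)}(0)`, that is, the integral
`∫ ∫ z⁺ 1_{E(y)} f(0, z, y) dz dy`, where `f` is the joint density of
`(Z(0), Z_t(0), W_x(0, 0))`. -/
def riceIntegral (f : ℝ × ℝ × ℝ → ℝ) (E : ℝ → Prop) : ℝ :=
  ∫ q : ℝ × ℝ, riceIntegrand f E q

/-! ### The closed form -/

/-- The standard normal distribution function `Φ`. -/
def stdNormalCDF (x : ℝ) : ℝ := cdf (gaussianReal 0 1) x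

/-- The correlation `ρ` of `Z_t` and `W_x`, in terms of spectral moments and the velocity. -/
def corr (κ : ℝ → ℝ) (S : ℝ × ℝ → ℝ) (v : ℝ) : ℝ :=
  (v * spectralMoment κ S 2 0 + spectralMoment κ S 1 1) /
    Real.sqrt (spectralMoment κ S 2 0 *
      (v ^ 2 * spectralMoment κ S 2 0 + 2 * v * spectralMoment κ S 1 1 + spectralMoment κ S 0 2))

end EncounteredSea

end

open EncounteredSea

/-! The theorem is a marked Rice formula for the encountered sea `Z`, followed by an explicit
Gaussian integral.

Everything probabilistic comes from one fact: a linear combination of values of the field is centred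
Gaussian, with variance the spectral integral of the squared modulus of the corresponding
combination of waves (`integral_sum_sq`, `integral_exp_sum`). Almost sure differentiability makes
difference quotients converge, so their Gaussian variances stay bounded, and Fatou's lemma gives
finite second order moments (`integrableOn_limitIntegrand`). A combination of the phases `ω` and
`κ(ω) cos θ` vanishes only on a null set, so the covariance form is positive definite
(`quadForm_pos`).

For Rice's formula, `[0, 1]` is cut into dyadic intervals. About the centre of an interval, the mean
of the two endpoint values is even and the symmetric quotients in time and space are odd. Hence the
mean is exactly independent of the quotients, even before passing to the limit
(`map_triple_eq_prod`). An upcrossing over the interval says that the mean is smaller in absolute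
value than half the increment, so the expected marked count is computed by integrating out one
Gaussian variable (`lintegral_upcrossing`), and its limit is `E[Z_t⁺ G(Z_t, W_x)]` times the density
of `Z(0)` at zero. Pathwise, the marked counts converge to the sum over the zeros if marks vanish at
small derivatives (`tendsto_sum_upInd`); tangential zeros therefore need no separate treatment.
Unmarked dyadic counts increase with bounded expectation and provide the majorant. Monotone
approximation passes from continuous marks to indicators of open sets (`lintegral_encard`).

For the closed form, regression gives `Z_t = R + β W_x` with `R` independent of `W_x`. Integrating
out `R` gives the mean positive part of a Gaussian variable (`posPartMean`), and its product with
the density of the slope has an elementary antiderivative in terms of `Φ`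
(`hasDerivAt_slopePrimitive`). The ratio of two values of this antiderivative is the stated formula.
-/

noncomputable section

namespace EncounteredSea

open Filter Topology
open scoped NNReal

/-! ### Characteristic functions of linear combinations of values of the field -/

/-- The phase `ω τ + κ(ω) ξ cos θ` at the space-time point `d = (ξ, τ)`. -/
def phase (κ : ℝ → ℝ) (d : ℝ × ℝ) (p : ℝ × ℝ) : ℝ :=
  p.1 * d.2 + κ p.1 * d.1 * Real.cos p.2

lemma phase_add (κ : ℝ → ℝ) (d e p : ℝ × ℝ) :
    phase κ (d + e) p = phase κ d p + phase κ e p := by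
  simp only [phase, Prod.fst_add, Prod.snd_add]; ring

lemma phase_sub (κ : ℝ → ℝ) (d e p : ℝ × ℝ) :
    phase κ (d - e) p = phase κ d p - phase κ e p := by
  simp only [phase, Prod.fst_sub, Prod.snd_sub]; ring

lemma phase_smul (κ : ℝ → ℝ) (r : ℝ) (d p : ℝ × ℝ) :
    phase κ (r • d) p = r * phase κ d p := by
  simp only [phase, Prod.smul_fst, Prod.smul_snd, smul_eq_mul]; ring

lemma IsDispersionLaw.measurable_phase {κ : ℝ → ℝ} (hκ : IsDispersionLaw κ) (d : ℝ × ℝ) :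
    Measurable (phase κ d) := by
  have := hκ.measurable
  unfold phase
  fun_prop

lemma measurableSet_spectralDomain : MeasurableSet spectralDomain :=
  measurableSet_Ioi.prod measurableSet_Icc

lemma IsSpectralDensity.integrableOn_mul {S : ℝ × ℝ → ℝ} (hS : IsSpectralDensity S)
    {g : ℝ × ℝ → ℝ} (hg : Measurable g) {C : ℝ} (hC : ∀ p, |g p| ≤ C) :
    IntegrableOn (fun p => g p * S p) spectralDomain :=
  hS.integrable.bdd_mul (c := C) hg.aestronglyMeasurable (ae_of_all _ hC)

section
variable {Ω : Type*} [MeasurableSpace Ω] {μ : Measure Ω}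
  {κ : ℝ → ℝ} {S : ℝ × ℝ → ℝ} {W : ℝ × ℝ → Ω → ℝ}

lemma covarianceFunction_eq (κ : ℝ → ℝ) (S : ℝ × ℝ → ℝ) (d : ℝ × ℝ) :
    covarianceFunction κ S d.1 d.2 = ∫ p in spectralDomain, Real.cos (phase κ d p) * S p := rfl

lemma IsGaussianSea.hasGaussianLaw_sum (hW : IsGaussianSea μ κ S W) {ι : Type*} [Fintype ι]
    (c : ι → ℝ) (x : ι → ℝ × ℝ) : HasGaussianLaw (fun o => ∑ i, c i * W (x i) o) μ := by
  have h := ((hW.gaussian.comp_right x).smul c).hasGaussianLaw_fun_sum (I := Finset.univ)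
  simpa [Function.comp] using h

lemma IsGaussianSea.memLp_two (hW : IsGaussianSea μ κ S W) (x : ℝ × ℝ) : MemLp (W x) 2 μ :=
  (hW.gaussian.hasGaussianLaw_eval x).memLp_two

lemma IsGaussianSea.covariance' (hW : IsGaussianSea μ κ S W) (x y : ℝ × ℝ) :
    ∫ o, W x o * W y o ∂μ = ∫ p in spectralDomain, Real.cos (phase κ (y - x) p) * S p := by
  have h := hW.covariance x.1 x.2 (y.1 - x.1) (y.2 - x.2)
  simp only [add_sub_cancel, Prod.mk.eta] at h
  rw [h]
  exact covarianceFunction_eq κ S (y - x)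

lemma IsGaussianSea.integrable_mul (hW : IsGaussianSea μ κ S W) (x y : ℝ × ℝ) :
    Integrable (fun o => W x o * W y o) μ :=
  (hW.memLp_two x).integrable_mul (hW.memLp_two y)

lemma IsGaussianSea.integral_sum_eq_zero (hW : IsGaussianSea μ κ S W) {ι : Type*} [Fintype ι]
    (c : ι → ℝ) (x : ι → ℝ × ℝ) : ∫ o, ∑ i, c i * W (x i) o ∂μ = 0 := by
  rw [integral_finsetSum _ fun i _ =>
    ((hW.gaussian.hasGaussianLaw_eval (x i)).integrable).const_mul _]
  simp [integral_const_mul, hW.mean_zero]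

/-- Since `cos (a - b)` splits as a sum of two products, the double sum of covariances is, under the
spectral integral, the squared modulus of `∑ c i * exp (I * phase)`. -/
lemma IsGaussianSea.integral_sum_sq (hκ : IsDispersionLaw κ) (hS : IsSpectralDensity S)
    (hW : IsGaussianSea μ κ S W) {ι : Type*} [Fintype ι]
    (c : ι → ℝ) (x : ι → ℝ × ℝ) : ∫ o, (∑ i, c i * W (x i) o) ^ 2 ∂μ =
      ∫ p in spectralDomain, ((∑ i, c i * Real.cos (phase κ (x i) p)) ^ 2
        + (∑ i, c i * Real.sin (phase κ (x i) p)) ^ 2) * S p := by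
  have e1 : ∀ o, (∑ i, c i * W (x i) o) ^ 2
      = ∑ i, ∑ j, c i * c j * (W (x i) o * W (x j) o) := fun o => by
    rw [sq, Finset.sum_mul_sum]
    exact Finset.sum_congr rfl fun i _ => Finset.sum_congr rfl fun j _ => by ring
  have e2 : ∀ p, ((∑ i, c i * Real.cos (phase κ (x i) p)) ^ 2
        + (∑ i, c i * Real.sin (phase κ (x i) p)) ^ 2) * S p
      = ∑ i, ∑ j, c i * c j * (Real.cos (phase κ (x j - x i) p) * S p) := fun p => by
    rw [sq, sq, Finset.sum_mul_sum, Finset.sum_mul_sum, ← Finset.sum_add_distrib, Finset.sum_mul]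
    refine Finset.sum_congr rfl fun i _ => ?_
    rw [← Finset.sum_add_distrib, Finset.sum_mul]
    refine Finset.sum_congr rfl fun j _ => ?_
    rw [phase_sub, Real.cos_sub]; ring
  have i2 : ∀ i j, IntegrableOn (fun p => Real.cos (phase κ (x j - x i) p) * S p)
      spectralDomain := fun i j =>
    hS.integrableOn_mul (Real.measurable_cos.comp (hκ.measurable_phase _))
      (fun p => Real.abs_cos_le_one _)
  simp only [e1, e2]
  rw [integral_finsetSum _ fun i _ => integrable_finsetSum _ fun j _ =>
    (hW.integrable_mul (x i) (x j)).const_mul _,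
    integral_finsetSum _ fun i _ => integrable_finsetSum _ fun j _ => (i2 i j).const_mul _]
  refine Finset.sum_congr rfl fun i _ => ?_
  rw [integral_finsetSum _ fun j _ =>
    (hW.integrable_mul (x i) (x j)).const_mul _,
    integral_finsetSum _ fun j _ => (i2 i j).const_mul _]
  refine Finset.sum_congr rfl fun j _ => ?_
  rw [integral_const_mul, integral_const_mul, hW.covariance']

lemma IsGaussianSea.integral_exp_sum (hκ : IsDispersionLaw κ) (hS : IsSpectralDensity S)
    (hW : IsGaussianSea μ κ S W) {ι : Type*} [Fintype ι] (c : ι → ℝ) (x : ι → ℝ × ℝ) :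
    ∫ o, Complex.exp (((∑ i, c i * W (x i) o : ℝ) : ℂ) * Complex.I) ∂μ =
      Complex.exp (-((∫ p in spectralDomain, ((∑ i, c i * Real.cos (phase κ (x i) p)) ^ 2
        + (∑ i, c i * Real.sin (phase κ (x i) p)) ^ 2) * S p : ℝ) : ℂ) / 2) := by
  have hg := hW.hasGaussianLaw_sum c x
  have hm := hg.map_eq_gaussianReal
  have h0 := hW.integral_sum_eq_zero c x
  have hv := variance_of_integral_eq_zero hg.aemeasurable h0
  have hsq := hW.integral_sum_sq hκ hS c x
  have key := congrArg (fun ν => charFun ν 1) hm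
  simp only [charFun_gaussianReal, h0] at key
  rw [charFun_apply_real, integral_map hg.aemeasurable (by fun_prop)] at key
  simp only [Complex.ofReal_one, one_mul] at key
  rw [key, hv, hsq, Complex.ofReal_zero, zero_mul, zero_sub, Real.coe_toNNReal, one_pow,
    mul_one, neg_div]
  rw [← hsq]
  exact integral_nonneg fun o => sq_nonneg _

/-! ### Symmetric difference quotients along the ray of the ship and in space -/

/-- The mean of two values of `F` on the ray of the ship, symmetric about time `t`. -/
def midValue (F : ℝ × ℝ → ℝ) (v h t : ℝ) : ℝ :=
  (F (v * (t + h / 2), t + h / 2) + F (v * (t - h / 2), t - h / 2)) / 2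

/-- The symmetric difference quotient of `F` along the ray of the ship. -/
def rayQuotient (F : ℝ × ℝ → ℝ) (v h t : ℝ) : ℝ :=
  (F (v * (t + h / 2), t + h / 2) - F (v * (t - h / 2), t - h / 2)) / h

/-- The symmetric difference quotient of `F` in the space direction. -/
def slopeQuotient (F : ℝ × ℝ → ℝ) (v h t : ℝ) : ℝ :=
  (F (v * t + h, t) - F (v * t - h, t)) / (2 * h)

/-- The variance of `a * midValue + b * rayQuotient + c * slopeQuotient`. -/
def tripleVar (κ : ℝ → ℝ) (S : ℝ × ℝ → ℝ) (v h a b c : ℝ) : ℝ :=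
  ∫ p in spectralDomain, ((a * Real.cos (h / 2 * phase κ (v, 1) p)) ^ 2
    + (b * (2 / h * Real.sin (h / 2 * phase κ (v, 1) p))
      + c * (1 / h * Real.sin (h * phase κ (1, 0) p))) ^ 2) * S p

/-- The coefficients of the values of the field in `a * midValue + b * rayQuotient
+ c * slopeQuotient`. -/
def tripleCoeff (h a b c : ℝ) : Fin 4 → ℝ :=
  ![a / 2 + b / h, a / 2 - b / h, c / (2 * h), -c / (2 * h)]

/-- The points used in `midValue`, `rayQuotient` and `slopeQuotient`. -/
def triplePoint (v h t : ℝ) : Fin 4 → ℝ × ℝ :=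
  ![(v * (t + h / 2), t + h / 2), (v * (t - h / 2), t - h / 2), (v * t + h, t), (v * t - h, t)]

lemma triple_eq_sum (F : ℝ × ℝ → ℝ) (v h t a b c : ℝ) :
    a * midValue F v h t + b * rayQuotient F v h t + c * slopeQuotient F v h t =
      ∑ i, tripleCoeff h a b c i * F (triplePoint v h t i) := by
  simp only [tripleCoeff, triplePoint, Fin.sum_univ_four, Matrix.cons_val, midValue, rayQuotient,
    slopeQuotient]
  ring

/-- With `ψ` the phase of `(v, 1)`, the combination of waves is `exp (I t ψ)` times a number
independent of `t`. The factor has modulus one and drops out. By symmetry about the centre, the mean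
contributes the real part of that number and the two quotients its imaginary part. -/
lemma tripleVar_eq_integral_sum (κ : ℝ → ℝ) (S : ℝ × ℝ → ℝ) (v h t a b c : ℝ) :
    tripleVar κ S v h a b c = ∫ p in spectralDomain,
      ((∑ i, tripleCoeff h a b c i * Real.cos (phase κ (triplePoint v h t i) p)) ^ 2
        + (∑ i, tripleCoeff h a b c i * Real.sin (phase κ (triplePoint v h t i) p)) ^ 2) * S p := by
  have e1 : ((v * (t + h / 2), t + h / 2) : ℝ × ℝ) = t • (v, 1) + (h / 2) • (v, 1) := by
    ext <;> simp; ring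
  have e2 : ((v * (t - h / 2), t - h / 2) : ℝ × ℝ) = t • (v, 1) - (h / 2) • (v, 1) := by
    ext <;> simp; ring
  have e3 : ((v * t + h, t) : ℝ × ℝ) = t • (v, 1) + h • (1, 0) := by
    ext <;> simp; ring
  have e4 : ((v * t - h, t) : ℝ × ℝ) = t • (v, 1) - h • (1, 0) := by
    ext <;> simp; ring
  unfold tripleVar
  congr 1 with p
  simp only [tripleCoeff, triplePoint, Fin.sum_univ_four, Matrix.cons_val]
  rw [e1, e2, e3, e4]
  simp only [phase_add, phase_sub, phase_smul]
  rw [Real.cos_add, Real.cos_add, Real.cos_sub, Real.cos_sub, Real.sin_add, Real.sin_add,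
    Real.sin_sub, Real.sin_sub]
  generalize phase κ (v, 1) p = ψ
  have h1 := Real.sin_sq_add_cos_sq (t * ψ)
  generalize Real.sin (t * ψ) = s at *
  generalize Real.cos (t * ψ) = r at *
  linear_combination (-(((a * Real.cos (h / 2 * ψ)) ^ 2 + (b * (2 / h * Real.sin (h / 2 * ψ))
    + c * (1 / h * Real.sin (h * phase κ (1, 0) p))) ^ 2) * S p)) * h1

lemma IsGaussianSea.integral_exp_triple (hκ : IsDispersionLaw κ) (hS : IsSpectralDensity S)
    (hW : IsGaussianSea μ κ S W) (v h t a b c : ℝ) :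
    ∫ o, Complex.exp (((a * midValue (W · o) v h t + b * rayQuotient (W · o) v h t
        + c * slopeQuotient (W · o) v h t : ℝ) : ℂ) * Complex.I) ∂μ =
      Complex.exp (-(tripleVar κ S v h a b c : ℂ) / 2) := by
  simp only [triple_eq_sum]
  rw [tripleVar_eq_integral_sum κ S v h t]
  exact hW.integral_exp_sum hκ hS _ _

lemma IsGaussianSea.integral_triple_sq (hκ : IsDispersionLaw κ) (hS : IsSpectralDensity S)
    (hW : IsGaussianSea μ κ S W) (v h t a b c : ℝ) :
    ∫ o, (a * midValue (W · o) v h t + b * rayQuotient (W · o) v h t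
        + c * slopeQuotient (W · o) v h t) ^ 2 ∂μ = tripleVar κ S v h a b c := by
  simp only [triple_eq_sum]
  rw [tripleVar_eq_integral_sum κ S v h t]
  exact hW.integral_sum_sq hκ hS _ _
end

/-! ### Difference quotients of a continuously differentiable function -/

/-- Strict differentiability is needed because both points move with `n`: the quotients are later
centred at midpoints of dyadic intervals, which only converge to the point of interest. -/
lemma tendsto_quotient_of_hasStrictFDerivAt {E : Type*} [NormedAddCommGroup E] [NormedSpace ℝ E]
    {F : E → ℝ} {F' : E →L[ℝ] ℝ} {x e : E} (hF : HasStrictFDerivAt F F' x)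
    {p q : ℕ → E} {r : ℕ → ℝ} (hr : ∀ n, r n ≠ 0) (hp : Tendsto p atTop (𝓝 x))
    (hq : Tendsto q atTop (𝓝 x)) (hpq : ∀ n, p n - q n = r n • e) :
    Tendsto (fun n => (F (p n) - F (q n)) / r n) atTop (𝓝 (F' e)) := by
  have h1 := hF.isLittleO.comp_tendsto (hp.prodMk_nhds hq)
  have h2 : (fun n => F (p n) - F (q n) - F' (p n - q n)) =o[atTop] r := by
    refine h1.trans_isBigO ?_
    refine Asymptotics.IsBigO.of_bound ‖e‖ (Eventually.of_forall fun n => ?_)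
    simp only [Function.comp, hpq, norm_smul]
    rw [mul_comm]
  have h3 := h2.tendsto_div_nhds_zero.add_const (F' e)
  rw [zero_add] at h3
  refine h3.congr fun n => ?_
  rw [hpq, map_smul, smul_eq_mul]
  field_simp [hr n]
  ring

section Path

variable {F : ℝ × ℝ → ℝ} (hF : ContDiff ℝ 1 F) (v : ℝ)

include hF

lemma hasDerivAt_ray (t : ℝ) :
    HasDerivAt (fun s => F (v * s, s)) (fderiv ℝ F (v * t, t) (v, 1)) t := by
  have h1 : HasDerivAt (fun s : ℝ => (v * s, s)) (v, 1) t := by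
    simpa using ((hasDerivAt_id t).const_mul v).prodMk (hasDerivAt_id t)
  exact ((hF.differentiable one_ne_zero (v * t, t)).hasFDerivAt).comp_hasDerivAt
    (f := fun s : ℝ => (v * s, s)) t h1

lemma hasDerivAt_space (x t : ℝ) :
    HasDerivAt (fun y => F (y, t)) (fderiv ℝ F (x, t) (1, 0)) x := by
  have h1 : HasDerivAt (fun s : ℝ => (s, t)) (1, 0) x :=
    (hasDerivAt_id x).prodMk (hasDerivAt_const x t)
  exact ((hF.differentiable one_ne_zero (x, t)).hasFDerivAt).comp_hasDerivAt
    (f := fun s : ℝ => (s, t)) x h1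

lemma continuous_deriv_ray : Continuous fun t => deriv (fun s => F (v * s, s)) t := by
  simp only [fun t => (hasDerivAt_ray hF v t).deriv]
  have := hF.continuous_fderiv one_ne_zero
  fun_prop

variable {h t : ℕ → ℝ} {t₀ : ℝ} (hh : Tendsto h atTop (𝓝 0)) (ht : Tendsto t atTop (𝓝 t₀))

include hh ht

lemma tendsto_midValue :
    Tendsto (fun n => midValue F v (h n) (t n)) atTop (𝓝 (F (v * t₀, t₀))) := by
  have hc := hF.continuous
  have h1 : Continuous fun q : ℝ × ℝ => midValue F v q.1 q.2 := by
    unfold midValue; fun_prop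
  have h2 := (h1.tendsto (0, t₀)).comp (hh.prodMk_nhds ht)
  simpa [midValue, Function.comp_def] using h2

lemma tendsto_rayQuotient (hne : ∀ n, h n ≠ 0) :
    Tendsto (fun n => rayQuotient F v (h n) (t n)) atTop
      (𝓝 (deriv (fun s => F (v * s, s)) t₀)) := by
  rw [(hasDerivAt_ray hF v t₀).deriv]
  have hp : Tendsto (fun n => t n + h n / 2) atTop (𝓝 t₀) := by
    simpa using ht.add (hh.div_const 2)
  have hq : Tendsto (fun n => t n - h n / 2) atTop (𝓝 t₀) := by
    simpa using ht.sub (hh.div_const 2)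
  refine tendsto_quotient_of_hasStrictFDerivAt
    (hF.contDiffAt.hasStrictFDerivAt one_ne_zero) hne ((hp.const_mul v).prodMk_nhds hp)
    ((hq.const_mul v).prodMk_nhds hq) fun n => ?_
  ext <;> simp; ring

lemma tendsto_slopeQuotient (hne : ∀ n, h n ≠ 0) :
    Tendsto (fun n => slopeQuotient F v (h n) (t n)) atTop
      (𝓝 (deriv (fun y => F (y, t₀)) (v * t₀))) := by
  rw [(hasDerivAt_space hF (v * t₀) t₀).deriv]
  have hp : Tendsto (fun n => v * t n + h n) atTop (𝓝 (v * t₀)) := by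
    simpa using (ht.const_mul v).add hh
  have hq : Tendsto (fun n => v * t n - h n) atTop (𝓝 (v * t₀)) := by
    simpa using (ht.const_mul v).sub hh
  refine tendsto_quotient_of_hasStrictFDerivAt
    (hF.contDiffAt.hasStrictFDerivAt one_ne_zero) (fun n => mul_ne_zero two_ne_zero (hne n))
    (hp.prodMk_nhds ht) (hq.prodMk_nhds ht) fun n => ?_
  ext <;> simp; ring

end Path

/-! ### Counting zeros along dyadic partitions -/

/-- The indicator of an upcrossing of zero by `z` in the `k`-th dyadic interval of order `n`. -/
def upInd (z : ℝ → ℝ) (n k : ℕ) : ℝ≥0∞ :=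
  {r : ℝ × ℝ | r.1 < 0 ∧ 0 < r.2}.indicator 1 (z (k / 2 ^ n), z ((k + 1) / 2 ^ n))

lemma upInd_eq_one {z : ℝ → ℝ} {n k : ℕ} (h0 : z (k / 2 ^ n) < 0) (h1 : 0 < z ((k + 1) / 2 ^ n)) :
    upInd z n k = 1 := indicator_of_mem (show _ ∈ {r : ℝ × ℝ | r.1 < 0 ∧ 0 < r.2} from ⟨h0, h1⟩) _

lemma upInd_ne_zero {z : ℝ → ℝ} {n k : ℕ} (h : upInd z n k ≠ 0) :
    z (k / 2 ^ n) < 0 ∧ 0 < z ((k + 1) / 2 ^ n) :=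
  mem_of_indicator_ne_zero (s := {r : ℝ × ℝ | r.1 < 0 ∧ 0 < r.2}) h

lemma sum_range_two_mul {M : Type*} [AddCommMonoid M] (f : ℕ → M) (m : ℕ) :
    ∑ k ∈ Finset.range (2 * m), f k = ∑ k ∈ Finset.range m, (f (2 * k) + f (2 * k + 1)) := by
  induction m with
  | zero => simp
  | succ m ih => rw [Nat.mul_succ, Finset.sum_range_succ, Finset.sum_range_succ, ih,
      Finset.sum_range_succ, add_assoc]

/-- The number of dyadic upcrossings is nondecreasing in the order of the partition. -/
lemma sum_upInd_le_succ {z : ℝ → ℝ} (hz : ∀ n k : ℕ, z (k / 2 ^ n) ≠ 0) (n : ℕ) :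
    ∑ k ∈ Finset.range (2 ^ n), upInd z n k ≤
      ∑ k ∈ Finset.range (2 ^ (n + 1)), upInd z (n + 1) k := by
  rw [pow_succ', sum_range_two_mul]
  refine Finset.sum_le_sum fun k _ => ?_
  by_cases h : upInd z n k = 0
  · simp [h]
  obtain ⟨h0, h1⟩ := upInd_ne_zero h
  rw [upInd_eq_one h0 h1]
  have e0 : ((2 * k : ℕ) : ℝ) / 2 ^ (n + 1) = k / 2 ^ n := by
    push_cast; rw [pow_succ']; field_simp
  have e1 : (((2 * k + 1 : ℕ) : ℝ) + 1) / 2 ^ (n + 1) = (k + 1) / 2 ^ n := by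
    push_cast; rw [pow_succ']; field_simp; ring
  rw [← e0] at h0
  rw [← e1] at h1
  -- The sign at the midpoint, which is nonzero, decides which half inherits the upcrossing.
  rcases (hz (n + 1) (2 * k + 1)).lt_or_gt with hc | hc
  · exact (upInd_eq_one hc h1).ge.trans le_add_self
  · refine (upInd_eq_one h0 ?_).ge.trans le_self_add
    push_cast at hc ⊢
    exact hc

/-- The set is closed in a compact interval, so an accumulation point would belong to it. There the
derivative is positive, which isolates the zero. -/
lemma finite_zeros_of_deriv_ge {z : ℝ → ℝ} (hz : Differentiable ℝ z)
    (hz' : Continuous (deriv z)) {δ : ℝ} (hδ : 0 < δ) :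
    {t ∈ Icc (0 : ℝ) 1 | z t = 0 ∧ δ ≤ deriv z t}.Finite := by
  by_contra hinf
  set K := {t ∈ Icc (0 : ℝ) 1 | z t = 0 ∧ δ ≤ deriv z t}
  obtain ⟨x, -, hx⟩ := (show K.Infinite from hinf).exists_accPt_of_subset_isCompact
    (isCompact_Icc (a := (0 : ℝ)) (b := 1)) (fun t ht => ht.1)
  have hcl : IsClosed K := by
    refine isClosed_Icc.inter ((isClosed_eq hz.continuous continuous_const).inter
      (isClosed_le continuous_const hz'))
  have hxK : x ∈ K := hcl.closure_subset (mem_closure_iff_clusterPt.mpr hx.clusterPt)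
  have h1 := (hz x).hasDerivAt.eventually_ne (c := 0) (hδ.trans_le hxK.2.2).ne'
  rw [accPt_iff_frequently_nhdsNE] at hx
  obtain ⟨y, hy, hy'⟩ := (hx.and_eventually h1).exists
  exact hy' hy.2.1

/-- The sum of a mark `g` over the zeros of `z` in `[0, 1]`. -/
def markedZeros (z : ℝ → ℝ) (g : ℝ → ℝ≥0∞) : ℝ≥0∞ :=
  ∑' t, {t ∈ Icc (0 : ℝ) 1 | z t = 0}.indicator g t

/-- Dyadic sums with approximate marks converge to the sum of the marks over the zeros, when marks
vanish at points with small derivative. -/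
lemma tendsto_sum_upInd {z : ℝ → ℝ} (hz : Differentiable ℝ z) (hz' : Continuous (deriv z))
    (hd : ∀ n k : ℕ, z (k / 2 ^ n) ≠ 0) {δ : ℝ} (hδ : 0 < δ) {g : ℝ → ℝ≥0∞}
    {G : ℕ → ℕ → ℝ≥0∞} (hg : ∀ t, deriv z t < δ → g t = 0)
    (hG : ∀ n k : ℕ, z ((k + 1) / 2 ^ n) - z (k / 2 ^ n) < δ / 2 ^ n → G n k = 0)
    (hlim : ∀ (t : ℝ) (k : ℕ → ℕ), Tendsto (fun n => ((k n : ℝ) + 1 / 2) / 2 ^ n) atTop (𝓝 t) →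
      Tendsto (fun n => G n (k n)) atTop (𝓝 (g t))) :
    Tendsto (fun n => ∑ k ∈ Finset.range (2 ^ n), upInd z n k * G n k) atTop
      (𝓝 (markedZeros z g)) := by
  -- The threshold is `δ / 2`, not `δ`: a large increment yields derivative at least `δ` only
  -- somewhere in the interval, and up to `δ / 2` is lost in moving to the zero.
  have hfin := finite_zeros_of_deriv_ge hz hz' (half_pos hδ)
  set K := hfin.toFinset with hK
  have memK : ∀ t, t ∈ K ↔ t ∈ Icc (0 : ℝ) 1 ∧ z t = 0 ∧ δ / 2 ≤ deriv z t := fun t => by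
    simp [hK]
  have hpow : Tendsto (fun n : ℕ => (1 : ℝ) / 2 ^ n) atTop (𝓝 0) := by
    simpa using tendsto_pow_atTop_nhds_zero_of_lt_one (r := (1 / 2 : ℝ)) (by norm_num) (by norm_num)
  have hp : ∀ n : ℕ, (0 : ℝ) < 2 ^ n := fun n => by positivity
  -- The index of the dyadic interval of order `n` that contains `t`.
  let κ : ℕ → ℝ → ℕ := fun n t => ⌊t * 2 ^ n⌋₊
  have lo : ∀ n t, 0 ≤ t → (κ n t : ℝ) / 2 ^ n ≤ t := fun n t h0 => by
    rw [div_le_iff₀ (hp n)]; exact Nat.floor_le (by positivity)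
  have hi : ∀ n t, t < ((κ n t : ℝ) + 1) / 2 ^ n := fun n t => by
    rw [lt_div_iff₀ (hp n)]; exact Nat.lt_floor_add_one _
  have lim0 : ∀ t, 0 ≤ t → Tendsto (fun n => (κ n t : ℝ) / 2 ^ n) atTop (𝓝 t) := fun t h0 => by
    refine tendsto_of_tendsto_of_tendsto_of_le_of_le (g := fun n : ℕ => t - 1 / 2 ^ n)
      (by simpa using hpow.const_sub t) tendsto_const_nhds (fun n => ?_) (fun n => lo n t h0)
    have := hi n t
    rw [add_div] at this
    show t - 1 / 2 ^ n ≤ _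
    linarith
  have lim1 : ∀ t, 0 ≤ t → Tendsto (fun n => ((κ n t : ℝ) + 1) / 2 ^ n) atTop (𝓝 t) :=
    fun t h0 => by simpa [add_div] using (lim0 t h0).add hpow
  have limh : ∀ t, 0 ≤ t → Tendsto (fun n => ((κ n t : ℝ) + 1 / 2) / 2 ^ n) atTop (𝓝 t) :=
    fun t h0 => by
      have := (lim0 t h0).add (hpow.div_const 2)
      simp only [zero_div, add_zero] at this
      refine this.congr fun n => by ring
  -- the limit as a finite sum
  have hsum : markedZeros z g = ∑ t ∈ K, g t := by
    unfold markedZeros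
    rw [tsum_eq_sum (s := K)]
    · refine Finset.sum_congr rfl fun t ht => indicator_of_mem ?_ _
      exact ⟨((memK t).1 ht).1, ((memK t).1 ht).2.1⟩
    · intro t ht
      by_contra hne
      have h1 := mem_of_indicator_ne_zero hne
      rw [indicator_of_mem h1] at hne
      refine ht ((memK t).2 ⟨h1.1, h1.2, ?_⟩)
      by_contra hlt
      exact hne (hg t (by linarith [not_le.1 hlt]))
  -- eventually there is an upcrossing in the interval of each zero
  have hC : ∀ᶠ n in atTop, ∀ t ∈ K, upInd z n (κ n t) = 1 := by
    rw [eventually_all_finset]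
    intro t ht
    obtain ⟨⟨h0, h1⟩, hz0, hpos⟩ := (memK t).1 ht
    have hpos' : 0 < deriv z t := (half_pos hδ).trans_le hpos
    have hder := (hz t).hasDerivAt
    have hs := hder.tendsto_slope
    have hev : ∀ᶠ s in 𝓝[≠] t, 0 < _root_.slope z t s := hs.eventually (lt_mem_nhds hpos')
    rw [eventually_nhdsWithin_iff] at hev
    filter_upwards [(lim0 t h0).eventually hev, (lim1 t h0).eventually hev] with n e0 e1
    have hlt : (κ n t : ℝ) / 2 ^ n < t := (lo n t h0).lt_of_ne fun h => hd n (κ n t) (by rw [h, hz0])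
    have e0 := e0 hlt.ne
    have e1 := e1 (hi n t).ne'
    rw [slope_def_field, hz0, sub_zero] at e0 e1
    refine upInd_eq_one ?_ ?_
    · by_contra hneg
      exact absurd e0 (not_lt.2 (div_nonpos_of_nonneg_of_nonpos (not_lt.1 hneg)
        (sub_nonpos.2 hlt.le)))
    · by_contra hneg
      exact absurd e1 (not_lt.2 (div_nonpos_of_nonpos_of_nonneg (not_lt.1 hneg)
        (sub_nonneg.2 (hi n t).le)))
  have hinj : ∀ᶠ n in atTop, ∀ t ∈ K, ∀ s ∈ K, κ n t = κ n s → t = s := by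
    rw [eventually_all_finset]
    intro t ht
    rw [eventually_all_finset]
    intro s hs
    by_cases hts : t = s
    · simp [hts]
    filter_upwards [((lim0 t ((memK t).1 ht).1.1).sub (lim0 s ((memK s).1 hs).1.1)).eventually_ne
      (sub_ne_zero.2 hts)] with n hn h
    simp [h] at hn
  have hrange : ∀ n, ∀ t ∈ K, κ n t ∈ Finset.range (2 ^ n) := fun n t ht => by
    obtain ⟨⟨h0, h1⟩, hz0, -⟩ := (memK t).1 ht
    -- The endpoint `1` is itself a dyadic point, so it is not a zero and the index stays below `2 ^
    -- n`.
    have h1' : t < 1 := h1.lt_of_ne fun h => hd 0 1 (by simpa [h] using hz0)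
    rw [Finset.mem_range, Nat.floor_lt (by positivity)]
    push_cast
    nlinarith [hp n]
  -- eventually all upcrossings with a nonzero mark come from zeros in `K`
  have hA : ∀ᶠ n in atTop, ∀ k ∈ Finset.range (2 ^ n), upInd z n k * G n k ≠ 0 →
      ∃ t ∈ K, κ n t = k := by
    have huc := (isCompact_Icc (a := (0 : ℝ)) (b := 1)).uniformContinuousOn_of_continuous
      hz'.continuousOn
    rw [Metric.uniformContinuousOn_iff] at huc
    obtain ⟨η, hη, huc⟩ := huc (δ / 2) (half_pos hδ)
    filter_upwards [hpow.eventually (gt_mem_nhds hη)] with n hn k hk hne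
    obtain ⟨c0, c1⟩ := upInd_ne_zero (left_ne_zero_of_mul hne)
    have hD : δ / 2 ^ n ≤ z ((k + 1) / 2 ^ n) - z (k / 2 ^ n) := by
      by_contra hlt
      exact right_ne_zero_of_mul hne (hG n k (not_le.1 hlt))
    have hab : (k : ℝ) / 2 ^ n < (k + 1) / 2 ^ n := by
      apply div_lt_div_of_pos_right _ (hp n); linarith
    have hsub : Icc ((k : ℝ) / 2 ^ n) ((k + 1) / 2 ^ n) ⊆ Icc 0 1 := by
      refine Icc_subset_Icc (by positivity) ?_
      rw [div_le_one (hp n)]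
      have := Finset.mem_range.1 hk
      exact_mod_cast this
    obtain ⟨t, ht, hzt⟩ := intermediate_value_Ioo hab.le hz.continuous.continuousOn ⟨c0, c1⟩
    -- The mean slope over the interval is at least `δ`, hence so is the derivative at some `ξ`. The
    -- interval is shorter than the modulus of continuity `η`, so the derivative at the zero `t`
    -- exceeds `δ / 2`.
    obtain ⟨ξ, hξ, hξ'⟩ := exists_deriv_eq_slope z hab hz.continuous.continuousOn
      (hz.differentiableOn)
    have hdξ : δ ≤ deriv z ξ := by
      rw [hξ', le_div_iff₀ (by linarith)]
      calc δ * (((k : ℝ) + 1) / 2 ^ n - k / 2 ^ n) = δ / 2 ^ n := by ring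
        _ ≤ _ := hD
    have htm := hsub (Ioo_subset_Icc_self ht)
    have hclose : dist (deriv z ξ) (deriv z t) < δ / 2 := by
      refine huc ξ (hsub (Ioo_subset_Icc_self hξ)) t htm ?_
      rw [Real.dist_eq, abs_lt]
      have e : ((k : ℝ) + 1) / 2 ^ n = k / 2 ^ n + 1 / 2 ^ n := by ring
      constructor <;> linarith [ht.1, ht.2, hξ.1, hξ.2]
    refine ⟨t, (memK t).2 ⟨htm, hzt, ?_⟩, ?_⟩
    · rw [Real.dist_eq, abs_lt] at hclose; linarith [hclose.2]
    · rw [Nat.floor_eq_iff (by have := htm.1; positivity)]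
      constructor
      · have := ht.1.le; rwa [div_le_iff₀ (hp n)] at this
      · have := ht.2; rwa [lt_div_iff₀ (hp n)] at this
  rw [hsum]
  have hlimK : Tendsto (fun n => ∑ t ∈ K, G n (κ n t)) atTop (𝓝 (∑ t ∈ K, g t)) :=
    tendsto_finsetSum _ fun t ht => hlim t (fun n => κ n t) (limh t ((memK t).1 ht).1.1)
  refine hlimK.congr' ?_
  filter_upwards [hC, hinj, hA] with n hCn hin hAn
  symm
  calc ∑ k ∈ Finset.range (2 ^ n), upInd z n k * G n k
      = ∑ k ∈ K.image (κ n), upInd z n k * G n k := by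
        symm
        refine Finset.sum_subset ?_ ?_
        · intro k hk
          obtain ⟨t, ht, rfl⟩ := Finset.mem_image.1 hk
          exact hrange n t ht
        · intro k hk hk'
          by_contra hne
          obtain ⟨t, ht, rfl⟩ := hAn k hk hne
          exact hk' (Finset.mem_image_of_mem _ ht)
    _ = ∑ t ∈ K, upInd z n (κ n t) * G n (κ n t) :=
        Finset.sum_image fun t ht s hs h => hin t ht s hs h
    _ = ∑ t ∈ K, G n (κ n t) := Finset.sum_congr rfl fun t ht => by rw [hCn t ht, one_mul]

/-! ### Finiteness of the spectral moments -/

lemma tendsto_integral_exp_mul_I {Ω : Type*} [MeasurableSpace Ω] {μ : Measure Ω}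
    [IsFiniteMeasure μ] {X : ℕ → Ω → ℝ} {Y : Ω → ℝ} (hX : ∀ n, AEMeasurable (X n) μ)
    (hlim : ∀ᵐ o ∂μ, Tendsto (fun n => X n o) atTop (𝓝 (Y o))) :
    Tendsto (fun n => ∫ o, Complex.exp ((X n o : ℂ) * Complex.I) ∂μ) atTop
      (𝓝 (∫ o, Complex.exp ((Y o : ℂ) * Complex.I) ∂μ)) := by
  refine tendsto_integral_of_dominated_convergence (fun _ => 1) (fun n => ?_)
    (integrable_const _) (fun n => ae_of_all _ fun o => ?_) ?_
  · have := hX n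
    exact AEMeasurable.aestronglyMeasurable (by fun_prop)
  · rw [Complex.norm_exp_ofReal_mul_I]
  · filter_upwards [hlim] with o ho
    have : Continuous fun x : ℝ => Complex.exp ((x : ℂ) * Complex.I) := by fun_prop
    exact (this.tendsto _).comp ho

/-- The variances of an almost surely convergent sequence of centred Gaussian variables are
bounded. -/
lemma eventually_variance_le {Ω : Type*} [MeasurableSpace Ω] {μ : Measure Ω}
    [IsProbabilityMeasure μ] {X : ℕ → Ω → ℝ} {Y : Ω → ℝ} (hX : ∀ n, AEMeasurable (X n) μ)
    (hlim : ∀ᵐ o ∂μ, Tendsto (fun n => X n o) atTop (𝓝 (Y o))) {V : ℕ → ℝ}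
    (hV : ∀ (s : ℝ) n, ∫ o, Complex.exp (((s * X n o : ℝ) : ℂ) * Complex.I) ∂μ
      = Complex.exp (-((s ^ 2 * V n : ℝ) : ℂ) / 2)) :
    ∃ C, ∀ᶠ n in atTop, V n ≤ C := by
  have hY : AEMeasurable Y μ := aemeasurable_of_tendsto_metrizable_ae' hX hlim
  have hprob : IsProbabilityMeasure (μ.map Y) := Measure.isProbabilityMeasure_map hY
  have hc : Continuous (charFun (μ.map Y)) := continuous_charFun
  have h0 : ‖charFun (μ.map Y) 0‖ = 1 := by simp
  -- The characteristic function of the limit law is continuous with value `1` at `0`, so its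
  -- modulus exceeds `1 / 2` at some `s ≠ 0`.
  have hev : ∀ᶠ s in 𝓝[≠] (0 : ℝ), 1 / 2 < ‖charFun (μ.map Y) s‖ :=
    (hc.norm.tendsto 0).mono_left nhdsWithin_le_nhds |>.eventually
      (lt_mem_nhds (by rw [h0]; norm_num))
  obtain ⟨s, hs, hs0⟩ := (hev.and self_mem_nhdsWithin).exists
  have hs0 : s ≠ 0 := hs0
  have hlims := tendsto_integral_exp_mul_I (X := fun n o => s * X n o) (Y := fun o => s * Y o)
    (fun n => (hX n).const_mul s) (by filter_upwards [hlim] with o ho using ho.const_mul s)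
  have hφ : charFun (μ.map Y) s = ∫ o, Complex.exp (((s * Y o : ℝ) : ℂ) * Complex.I) ∂μ := by
    rw [charFun_apply_real, integral_map hY (by fun_prop)]
    simp
  rw [hφ] at hs
  -- This is the solution `V` of `exp (-s ^ 2 * V / 2) = 1 / 2`.
  refine ⟨2 * Real.log 2 / s ^ 2, ?_⟩
  filter_upwards [hlims.norm.eventually (lt_mem_nhds hs)] with n hn
  rw [hV, Complex.norm_exp] at hn
  have e : (-((s ^ 2 * V n : ℝ) : ℂ) / 2).re = -(s ^ 2 * V n) / 2 := by
    have : (-((s ^ 2 * V n : ℝ) : ℂ) / 2) = ((-(s ^ 2 * V n) / 2 : ℝ) : ℂ) := by push_cast; ring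
    rw [this, Complex.ofReal_re]
  rw [e] at hn
  have h2 := Real.log_lt_log (by norm_num) hn
  rw [Real.log_exp, one_div, Real.log_inv] at h2
  rw [le_div_iff₀ (by positivity)]
  linarith

lemma tendsto_inv_mul_sin {h : ℕ → ℝ} (hh : Tendsto h atTop (𝓝 0)) (hne : ∀ n, h n ≠ 0) (x : ℝ) :
    Tendsto (fun n => 1 / h n * Real.sin (h n * x)) atTop (𝓝 x) := by
  have h1 : HasDerivAt (fun s => Real.sin (s * x)) x 0 := by
    have := ((hasDerivAt_id (0 : ℝ)).mul_const x).sin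
    simpa using this
  have h2 := h1.tendsto_slope.comp (tendsto_nhdsWithin_iff.2 ⟨hh, Eventually.of_forall hne⟩)
  refine h2.congr fun n => ?_
  simp [slope_def_field]
  ring

lemma abs_inv_mul_sin_le {h : ℝ} (hne : h ≠ 0) (x : ℝ) : |1 / h * Real.sin (h * x)| ≤ |x| := by
  rw [abs_mul, abs_div, abs_one, one_div, inv_mul_le_iff₀ (abs_pos.2 hne), ← abs_mul]
  exact Real.abs_sin_le_abs

lemma two_div_mul_sin (h x : ℝ) :
    2 / h * Real.sin (h / 2 * x) = 1 / (h / 2) * Real.sin (h / 2 * x) := by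
  rw [one_div_div]

/-- The lengths of the dyadic intervals. -/
def dyadicStep (n : ℕ) : ℝ := 1 / 2 ^ n

lemma dyadicStep_pos (n : ℕ) : 0 < dyadicStep n := by unfold dyadicStep; positivity

lemma dyadicStep_ne_zero (n : ℕ) : dyadicStep n ≠ 0 := (dyadicStep_pos n).ne'

lemma tendsto_dyadicStep : Tendsto dyadicStep atTop (𝓝 0) := by
  unfold dyadicStep
  simpa using tendsto_pow_atTop_nhds_zero_of_lt_one (r := (1 / 2 : ℝ)) (by norm_num) (by norm_num)

section
variable {Ω : Type*} [MeasurableSpace Ω] {μ : Measure Ω}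
  {κ : ℝ → ℝ} {S : ℝ × ℝ → ℝ} {W : ℝ × ℝ → Ω → ℝ}

lemma IsGaussianSea.aemeasurable (hW : IsGaussianSea μ κ S W) (x : ℝ × ℝ) : AEMeasurable (W x) μ :=
  hW.gaussian.aemeasurable x

lemma IsGaussianSea.aemeasurable_midValue (hW : IsGaussianSea μ κ S W) (v h t : ℝ) :
    AEMeasurable (fun o => midValue (W · o) v h t) μ :=
  ((hW.aemeasurable _).add (hW.aemeasurable _)).div_const _

lemma IsGaussianSea.aemeasurable_rayQuotient (hW : IsGaussianSea μ κ S W) (v h t : ℝ) :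
    AEMeasurable (fun o => rayQuotient (W · o) v h t) μ :=
  ((hW.aemeasurable _).sub (hW.aemeasurable _)).div_const _

lemma IsGaussianSea.aemeasurable_slopeQuotient (hW : IsGaussianSea μ κ S W) (v h t : ℝ) :
    AEMeasurable (fun o => slopeQuotient (W · o) v h t) μ :=
  ((hW.aemeasurable _).sub (hW.aemeasurable _)).div_const _

lemma IsGaussianSea.ae_tendsto_triple (hW : IsGaussianSea μ κ S W) (v t : ℝ) :
    ∀ᵐ o ∂μ, Tendsto (fun n => midValue (W · o) v (dyadicStep n) t) atTop
        (𝓝 (encountered W v t o)) ∧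
      Tendsto (fun n => rayQuotient (W · o) v (dyadicStep n) t) atTop
        (𝓝 (encounteredDeriv W v t o)) ∧
      Tendsto (fun n => slopeQuotient (W · o) v (dyadicStep n) t) atTop
        (𝓝 (slope W (v * t) t o)) := by
  filter_upwards [hW.contDiff] with o ho
  exact ⟨tendsto_midValue ho v tendsto_dyadicStep tendsto_const_nhds,
    tendsto_rayQuotient ho v tendsto_dyadicStep tendsto_const_nhds dyadicStep_ne_zero,
    tendsto_slopeQuotient ho v tendsto_dyadicStep tendsto_const_nhds dyadicStep_ne_zero⟩

lemma IsGaussianSea.aemeasurable_encounteredDeriv (hW : IsGaussianSea μ κ S W) (v t : ℝ) :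
    AEMeasurable (encounteredDeriv W v t) μ :=
  aemeasurable_of_tendsto_metrizable_ae' (fun _ => hW.aemeasurable_rayQuotient v _ t)
    ((hW.ae_tendsto_triple v t).mono fun _ h => h.2.1)

lemma IsGaussianSea.aemeasurable_slope (hW : IsGaussianSea μ κ S W) (v t : ℝ) :
    AEMeasurable (slope W (v * t) t) μ :=
  aemeasurable_of_tendsto_metrizable_ae' (fun _ => hW.aemeasurable_slopeQuotient v _ t)
    ((hW.ae_tendsto_triple v t).mono fun _ h => h.2.2)

/-! ### Limits of the variances and finiteness of the second order moments -/

/-- The integrand of `tripleVar`. -/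
def tripleIntegrand (κ : ℝ → ℝ) (v h a b c : ℝ) (p : ℝ × ℝ) : ℝ :=
  (a * Real.cos (h / 2 * phase κ (v, 1) p)) ^ 2
    + (b * (2 / h * Real.sin (h / 2 * phase κ (v, 1) p))
      + c * (1 / h * Real.sin (h * phase κ (1, 0) p))) ^ 2

/-- The limit of `tripleIntegrand` for small steps. -/
def limitIntegrand (κ : ℝ → ℝ) (v a b c : ℝ) (p : ℝ × ℝ) : ℝ :=
  a ^ 2 + (b * phase κ (v, 1) p + c * phase κ (1, 0) p) ^ 2

lemma tripleVar_eq (κ : ℝ → ℝ) (S : ℝ × ℝ → ℝ) (v h a b c : ℝ) :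
    tripleVar κ S v h a b c = ∫ p in spectralDomain, tripleIntegrand κ v h a b c p * S p := rfl

lemma tripleVar_mul (κ : ℝ → ℝ) (S : ℝ × ℝ → ℝ) (v h a b c s : ℝ) :
    tripleVar κ S v h (s * a) (s * b) (s * c) = s ^ 2 * tripleVar κ S v h a b c := by
  rw [tripleVar_eq, tripleVar_eq, ← integral_const_mul]
  congr 1 with p
  simp only [tripleIntegrand]
  ring

lemma IsDispersionLaw.measurable_tripleIntegrand (hκ : IsDispersionLaw κ) (v h a b c : ℝ) :
    Measurable (tripleIntegrand κ v h a b c) := by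
  have h1 := hκ.measurable_phase (v, 1)
  have h2 := hκ.measurable_phase (1, 0)
  unfold tripleIntegrand
  fun_prop

lemma tripleIntegrand_nonneg (κ : ℝ → ℝ) (v h a b c : ℝ) (p : ℝ × ℝ) :
    0 ≤ tripleIntegrand κ v h a b c p := by unfold tripleIntegrand; positivity

lemma IsSpectralDensity.integrableOn_tripleIntegrand (hκ : IsDispersionLaw κ)
    (hS : IsSpectralDensity S) (v h a b c : ℝ) :
    IntegrableOn (fun p => tripleIntegrand κ v h a b c p * S p) spectralDomain := by
  refine hS.integrableOn_mul (hκ.measurable_tripleIntegrand v h a b c)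
    (C := a ^ 2 + (|b * (2 / h)| + |c * (1 / h)|) ^ 2) fun p => ?_
  rw [abs_of_nonneg (tripleIntegrand_nonneg ..)]
  unfold tripleIntegrand
  refine add_le_add ?_ (sq_le_sq' ?_ ?_)
  · rw [mul_pow]
    exact mul_le_of_le_one_right (sq_nonneg a) (Real.cos_sq_le_one _)
  all_goals
    have h1 : |b * (2 / h * Real.sin (h / 2 * phase κ (v, 1) p))| ≤ |b * (2 / h)| := by
      rw [← mul_assoc, abs_mul]
      exact mul_le_of_le_one_right (abs_nonneg _) (Real.abs_sin_le_one _)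
    have h2 : |c * (1 / h * Real.sin (h * phase κ (1, 0) p))| ≤ |c * (1 / h)| := by
      rw [← mul_assoc, abs_mul]
      exact mul_le_of_le_one_right (abs_nonneg _) (Real.abs_sin_le_one _)
    linarith [abs_le.1 h1, abs_le.1 h2]

lemma tendsto_tripleIntegrand (κ : ℝ → ℝ) (v a b c : ℝ) (p : ℝ × ℝ) :
    Tendsto (fun n => tripleIntegrand κ v (dyadicStep n) a b c p) atTop
      (𝓝 (limitIntegrand κ v a b c p)) := by
  unfold tripleIntegrand limitIntegrand
  have hh : Tendsto (fun n => dyadicStep n / 2) atTop (𝓝 0) := by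
    simpa using tendsto_dyadicStep.div_const 2
  have h1 := tendsto_inv_mul_sin hh (fun n => (half_pos (dyadicStep_pos n)).ne')
    (phase κ (v, 1) p)
  have h2 := tendsto_inv_mul_sin tendsto_dyadicStep dyadicStep_ne_zero (phase κ (1, 0) p)
  have h3 : Tendsto (fun n => a * Real.cos (dyadicStep n / 2 * phase κ (v, 1) p)) atTop
      (𝓝 (a * 1)) := by
    refine Tendsto.const_mul a ?_
    have := (Real.continuous_cos.tendsto 0).comp
      (by simpa using hh.mul_const (phase κ (v, 1) p) :
        Tendsto (fun n => dyadicStep n / 2 * phase κ (v, 1) p) atTop (𝓝 0))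
    simpa [Function.comp_def] using this
  simp only [two_div_mul_sin]
  rw [mul_one] at h3
  exact (h3.pow 2).add (((h1.const_mul b).add (h2.const_mul c)).pow 2)

variable [IsProbabilityMeasure μ]

/-- The finite-step combinations converge almost surely, so their variances are eventually bounded
by some `C`. These variances are spectral integrals of nonnegative functions converging pointwise to
the limit integrand, and Fatou's lemma bounds its integral by `C`. -/
lemma IsGaussianSea.integrableOn_limitIntegrand (hκ : IsDispersionLaw κ)
    (hS : IsSpectralDensity S) (hW : IsGaussianSea μ κ S W) (v a b c : ℝ) :
    IntegrableOn (fun p => limitIntegrand κ v a b c p * S p) spectralDomain := by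
  obtain ⟨C, hC⟩ := eventually_variance_le (μ := μ)
    (X := fun n o => a * midValue (W · o) v (dyadicStep n) 0
      + b * rayQuotient (W · o) v (dyadicStep n) 0 + c * slopeQuotient (W · o) v (dyadicStep n) 0)
    (Y := fun o => a * encountered W v 0 o + b * encounteredDeriv W v 0 o
      + c * slope W (v * 0) 0 o) (V := fun n => tripleVar κ S v (dyadicStep n) a b c)
    (fun n => (((hW.aemeasurable_midValue v _ 0).const_mul a).add
      ((hW.aemeasurable_rayQuotient v _ 0).const_mul b)).add
      ((hW.aemeasurable_slopeQuotient v _ 0).const_mul c))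
    (by
      filter_upwards [hW.ae_tendsto_triple v 0] with o ho
      exact ((ho.1.const_mul a).add (ho.2.1.const_mul b)).add (ho.2.2.const_mul c))
    (fun s n => by
      rw [← tripleVar_mul, ← hW.integral_exp_triple hκ hS v (dyadicStep n) 0]
      congr 1 with o
      congr 3
      ring)
  have hSm : AEStronglyMeasurable S (volume.restrict spectralDomain) := hS.integrable.1
  have hlm : Measurable (limitIntegrand κ v a b c) := by
    have h1 := hκ.measurable_phase (v, 1)
    have h2 := hκ.measurable_phase (1, 0)
    unfold limitIntegrand
    fun_prop
  have hnn : ∀ᵐ p ∂(volume.restrict spectralDomain), 0 ≤ S p := by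
    filter_upwards [ae_restrict_mem measurableSet_spectralDomain] with p hp using hS.nonneg p hp
  refine ⟨hlm.aestronglyMeasurable.mul hSm, ?_⟩
  rw [hasFiniteIntegral_iff_ofReal (by
    filter_upwards [hnn] with p hp
    exact mul_nonneg (by unfold limitIntegrand; positivity) hp)]
  calc ∫⁻ p in spectralDomain, ENNReal.ofReal (limitIntegrand κ v a b c p * S p)
      = ∫⁻ p in spectralDomain, liminf (fun n =>
          ENNReal.ofReal (tripleIntegrand κ v (dyadicStep n) a b c p * S p)) atTop := by
        refine lintegral_congr fun p => ?_
        exact (ENNReal.tendsto_ofReal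
          ((tendsto_tripleIntegrand κ v a b c p).mul_const (S p))).liminf_eq.symm
    _ ≤ liminf (fun n => ∫⁻ p in spectralDomain,
          ENNReal.ofReal (tripleIntegrand κ v (dyadicStep n) a b c p * S p)) atTop :=
        lintegral_liminf_le' fun n =>
          ((hκ.measurable_tripleIntegrand ..).aemeasurable.mul hSm.aemeasurable).ennreal_ofReal
    _ ≤ ENNReal.ofReal C := by
        refine liminf_le_of_frequently_le' (Eventually.frequently ?_)
        filter_upwards [hC] with n hn
        rw [← ofReal_integral_eq_lintegral_ofReal (hS.integrableOn_tripleIntegrand hκ ..) (by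
          filter_upwards [hnn] with p hp
          exact mul_nonneg (tripleIntegrand_nonneg ..) hp)]
        exact ENNReal.ofReal_le_ofReal hn
    _ < ⊤ := ENNReal.ofReal_lt_top

lemma IsGaussianSea.tendsto_tripleVar (hκ : IsDispersionLaw κ)
    (hS : IsSpectralDensity S) (hW : IsGaussianSea μ κ S W) (v a b c : ℝ) :
    Tendsto (fun n => tripleVar κ S v (dyadicStep n) a b c) atTop
      (𝓝 (∫ p in spectralDomain, limitIntegrand κ v a b c p * S p)) := by
  simp only [tripleVar_eq]
  -- The majorant is the sum of two limit integrands, from `|sin x| ≤ |x|` and `(x + y) ^ 2 ≤ 2 * x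
  -- ^ 2 + 2 * y ^ 2`; the doubled coefficients `2 * b` and `2 * c` leave room to spare.
  have i1 := hW.integrableOn_limitIntegrand hκ hS v a (2 * b) 0
  have i2 := hW.integrableOn_limitIntegrand hκ hS v 0 0 (2 * c)
  refine tendsto_integral_of_dominated_convergence _
    (fun n => (hS.integrableOn_tripleIntegrand hκ v _ a b c).1) (i1.add i2) (fun n => ?_)
    (ae_of_all _ fun p => (tendsto_tripleIntegrand κ v a b c p).mul_const _)
  filter_upwards [ae_restrict_mem measurableSet_spectralDomain] with p hp
  rw [Real.norm_of_nonneg (mul_nonneg (tripleIntegrand_nonneg ..) (hS.nonneg p hp)),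
    Pi.add_apply, ← add_mul]
  refine mul_le_mul_of_nonneg_right ?_ (hS.nonneg p hp)
  unfold tripleIntegrand limitIntegrand
  have h1 := sq_le_sq.2 (abs_inv_mul_sin_le (half_pos (dyadicStep_pos n)).ne' (phase κ (v, 1) p))
  have h2 := sq_le_sq.2 (abs_inv_mul_sin_le (dyadicStep_ne_zero n) (phase κ (1, 0) p))
  have h3 := Real.cos_sq_le_one (dyadicStep n / 2 * phase κ (v, 1) p)
  rw [two_div_mul_sin]
  generalize 1 / (dyadicStep n / 2) * Real.sin (dyadicStep n / 2 * phase κ (v, 1) p) = x at *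
  generalize 1 / dyadicStep n * Real.sin (dyadicStep n * phase κ (1, 0) p) = y at *
  generalize Real.cos (dyadicStep n / 2 * phase κ (v, 1) p) = r at *
  nlinarith [mul_le_mul_of_nonneg_left h1 (sq_nonneg b), mul_le_mul_of_nonneg_left h2 (sq_nonneg c),
    mul_le_mul_of_nonneg_left h3 (sq_nonneg a), sq_nonneg (b * x - c * y),
    sq_nonneg (b * phase κ (v, 1) p), sq_nonneg (c * phase κ (1, 0) p)]

/-- The spectral moments of order two are finite. -/
lemma IsGaussianSea.integrableOn_momentIntegrand (hκ : IsDispersionLaw κ)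
    (hS : IsSpectralDensity S) (hW : IsGaussianSea μ κ S W) (i j : ℕ) (hij : i + j = 2) :
    IntegrableOn (momentIntegrand κ S i j) spectralDomain := by
  -- For velocity `0` the two phases are `ω` and `κ(ω) cos θ`; the mixed moment then follows by
  -- polarization.
  have h20 := hW.integrableOn_limitIntegrand hκ hS 0 0 0 1
  have h02 := hW.integrableOn_limitIntegrand hκ hS 0 0 1 0
  have h11 := hW.integrableOn_limitIntegrand hκ hS 0 0 1 1
  have hi : i = 0 ∨ i = 1 ∨ i = 2 := by omega
  rcases hi with rfl | rfl | rfl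
  · obtain rfl : j = 2 := by omega
    refine h02.congr_fun (fun p _ => ?_) measurableSet_spectralDomain
    simp only [limitIntegrand, momentIntegrand, phase]; ring
  · obtain rfl : j = 1 := by omega
    refine IntegrableOn.congr_fun (((h11.sub h20).sub h02).div_const 2) (fun p _ => ?_)
      measurableSet_spectralDomain
    simp only [limitIntegrand, momentIntegrand, phase, Pi.sub_apply]; ring
  · obtain rfl : j = 0 := by omega
    refine h20.congr_fun (fun p _ => ?_) measurableSet_spectralDomain
    simp only [limitIntegrand, momentIntegrand, phase]; ring

/-! ### Nondegeneracy of the covariance form -/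

/-- The variance of the encountered velocity `Z_t`. -/
def rayVar (κ : ℝ → ℝ) (S : ℝ × ℝ → ℝ) (v : ℝ) : ℝ :=
  v ^ 2 * spectralMoment κ S 2 0 + 2 * v * spectralMoment κ S 1 1 + spectralMoment κ S 0 2

/-- The covariance of the encountered velocity `Z_t` and the slope `W_x`. -/
def rayCov (κ : ℝ → ℝ) (S : ℝ × ℝ → ℝ) (v : ℝ) : ℝ :=
  v * spectralMoment κ S 2 0 + spectralMoment κ S 1 1

lemma IsGaussianSea.integral_limitIntegrand (hκ : IsDispersionLaw κ)
    (hS : IsSpectralDensity S) (hW : IsGaussianSea μ κ S W) (v a b c : ℝ) :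
    ∫ p in spectralDomain, limitIntegrand κ v a b c p * S p =
      a ^ 2 * spectralMoment κ S 0 0 + b ^ 2 * rayVar κ S v + 2 * b * c * rayCov κ S v
        + c ^ 2 * spectralMoment κ S 2 0 := by
  have i00 : IntegrableOn (momentIntegrand κ S 0 0) spectralDomain := by
    refine hS.integrable.congr_fun (fun p _ => ?_) measurableSet_spectralDomain
    simp [momentIntegrand]
  have i20 := hW.integrableOn_momentIntegrand hκ hS 2 0 rfl
  have i11 := hW.integrableOn_momentIntegrand hκ hS 1 1 rfl
  have i02 := hW.integrableOn_momentIntegrand hκ hS 0 2 rfl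
  have e : ∀ p, limitIntegrand κ v a b c p * S p = a ^ 2 * momentIntegrand κ S 0 0 p
      + (b * v + c) ^ 2 * momentIntegrand κ S 2 0 p
      + 2 * b * (b * v + c) * momentIntegrand κ S 1 1 p + b ^ 2 * momentIntegrand κ S 0 2 p := by
    intro p
    simp only [limitIntegrand, momentIntegrand, phase]; ring
  simp only [e]
  rw [integral_add, integral_add, integral_add]
  · simp only [integral_const_mul, rayVar, rayCov, spectralMoment]
    ring
  · exact i00.const_mul _
  · exact i20.const_mul _
  · exact (i00.const_mul _).add (i20.const_mul _)
  · exact i11.const_mul _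
  · exact ((i00.const_mul _).add (i20.const_mul _)).add (i11.const_mul _)
  · exact i02.const_mul _

lemma countable_cos_eq (r : ℝ) : {θ | Real.cos θ = r}.Countable := by
  by_cases h : ∃ θ₀, Real.cos θ₀ = r
  · obtain ⟨θ₀, rfl⟩ := h
    refine ((countable_range fun k : ℤ => 2 * k * Real.pi + θ₀).union
      (countable_range fun k : ℤ => 2 * k * Real.pi - θ₀)).mono fun θ hθ => ?_
    obtain ⟨k, hk | hk⟩ := Real.cos_eq_cos_iff.1 (show Real.cos θ₀ = Real.cos θ from hθ.symm)
    · exact Or.inl ⟨k, hk.symm⟩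
    · exact Or.inr ⟨k, hk.symm⟩
  · convert countable_empty
    ext θ
    simpa using fun hθ => h ⟨θ, hθ⟩

/-- Fix `ω > 0`. If `c = 0` the expression is `b * ω ≠ 0`. Otherwise, since `κ ω > 0`, it vanishes
only where `cos θ` has one prescribed value, a countable set of `θ`. Fubini's theorem concludes. -/
lemma IsDispersionLaw.ae_ne_zero (hκ : IsDispersionLaw κ) {b c : ℝ} (hbc : b ≠ 0 ∨ c ≠ 0) :
    ∀ᵐ p ∂(volume.restrict spectralDomain), b * p.1 + c * (κ p.1 * Real.cos p.2) ≠ 0 := by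
  have hm : MeasurableSet {p : ℝ × ℝ | 0 < p.1 → b * p.1 + c * (κ p.1 * Real.cos p.2) ≠ 0} := by
    have := hκ.measurable
    refine MeasurableSet.imp (measurableSet_lt measurable_const measurable_fst) ?_
    exact (measurableSet_eq_fun (f := fun p : ℝ × ℝ => b * p.1 + c * (κ p.1 * Real.cos p.2))
      (g := fun _ => 0) (by fun_prop) measurable_const).compl
  have hae : ∀ᵐ p : ℝ × ℝ, 0 < p.1 → b * p.1 + c * (κ p.1 * Real.cos p.2) ≠ 0 := by
    rw [Measure.volume_eq_prod, Measure.ae_prod_iff_ae_ae hm]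
    refine ae_of_all _ fun ω => ?_
    by_cases hω : 0 < ω
    swap
    · simp [hω]
    by_cases hc : c = 0
    · have hb : b ≠ 0 := hbc.resolve_right (not_not.2 hc)
      simp [hc, hb, hω.ne']
    have hcnt := (countable_cos_eq (-(b * ω) / (c * κ ω))).measure_zero volume
    rw [← compl_mem_ae_iff] at hcnt
    filter_upwards [hcnt] with θ hθ _ h0
    refine hθ ?_
    have hk := (hκ.pos ω hω).ne'
    rw [mem_ofPred_eq, eq_div_iff (mul_ne_zero hc hk)]
    linarith
  filter_upwards [ae_restrict_of_ae hae, ae_restrict_mem measurableSet_spectralDomain] with p h1 h2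
  exact h1 h2.1

/-- The covariance form of `(Z_t, W_x)` is positive definite. -/
lemma IsGaussianSea.quadForm_pos (hκ : IsDispersionLaw κ)
    (hS : IsSpectralDensity S) (hS_pos : 0 < spectralMoment κ S 0 0)
    (hW : IsGaussianSea μ κ S W) (v : ℝ) {b c : ℝ} (hbc : b ≠ 0 ∨ c ≠ 0) :
    0 < b ^ 2 * rayVar κ S v + 2 * b * c * rayCov κ S v + c ^ 2 * spectralMoment κ S 2 0 := by
  have h := hW.integral_limitIntegrand hκ hS v 0 b c
  have hi := hW.integrableOn_limitIntegrand hκ hS v 0 b c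
  have hnn : ∀ᵐ p ∂(volume.restrict spectralDomain), 0 ≤ limitIntegrand κ v 0 b c p * S p := by
    filter_upwards [ae_restrict_mem measurableSet_spectralDomain] with p hp
    exact mul_nonneg (by unfold limitIntegrand; positivity) (hS.nonneg p hp)
  have h0 : 0 ≤ ∫ p in spectralDomain, limitIntegrand κ v 0 b c p * S p :=
    integral_nonneg_of_ae hnn
  rw [zero_pow two_ne_zero, zero_mul, zero_add] at h
  rw [← h]
  refine h0.lt_of_ne fun heq => ?_
  rw [eq_comm, integral_eq_zero_iff_of_nonneg_ae hnn hi] at heq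
  -- The linear form in the phases is `b * ω + (b * v + c) * κ(ω) cos θ`, and the shear `(b, c) ↦
  -- (b, b * v + c)` is injective.
  have hbc' : b ≠ 0 ∨ b * v + c ≠ 0 := by
    by_contra! hcon
    obtain ⟨rfl, h2⟩ := hcon
    simp at hbc h2
    exact hbc h2
  have hS0 : S =ᵐ[volume.restrict spectralDomain] 0 := by
    filter_upwards [heq, hκ.ae_ne_zero hbc'] with p h1 h2
    rcases mul_eq_zero.1 h1 with h3 | h3
    · refine absurd ?_ h2
      simp only [limitIntegrand, phase] at h3
      simp only [zero_pow two_ne_zero, zero_add, mul_one] at h3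
      have h4 := pow_eq_zero_iff two_ne_zero |>.1 h3
      linear_combination h4
    · exact h3
  have : spectralMoment κ S 0 0 = 0 := by
    unfold spectralMoment momentIntegrand
    simpa using integral_congr_ae hS0
  exact hS_pos.ne' this

lemma IsGaussianSea.moment20_pos (hκ : IsDispersionLaw κ) (hS : IsSpectralDensity S)
    (hS_pos : 0 < spectralMoment κ S 0 0) (hW : IsGaussianSea μ κ S W) :
    0 < spectralMoment κ S 2 0 := by
  simpa using hW.quadForm_pos hκ hS hS_pos 0 (b := 0) (c := 1) (by simp)

lemma IsGaussianSea.rayVar_pos (hκ : IsDispersionLaw κ) (hS : IsSpectralDensity S)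
    (hS_pos : 0 < spectralMoment κ S 0 0) (hW : IsGaussianSea μ κ S W) (v : ℝ) :
    0 < rayVar κ S v := by
  simpa using hW.quadForm_pos hκ hS hS_pos v (b := 1) (c := 0) (by simp)

lemma IsGaussianSea.rayCov_sq_lt (hκ : IsDispersionLaw κ) (hS : IsSpectralDensity S)
    (hS_pos : 0 < spectralMoment κ S 0 0) (hW : IsGaussianSea μ κ S W) (v : ℝ) :
    rayCov κ S v ^ 2 < spectralMoment κ S 2 0 * rayVar κ S v := by
  have h0 := hW.moment20_pos hκ hS hS_pos
  -- At this vector the quadratic form equals `λ₂₀` times the determinant of the covariance matrix.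
  have h := hW.quadForm_pos hκ hS hS_pos v (b := spectralMoment κ S 2 0) (c := -rayCov κ S v)
    (Or.inl h0.ne')
  have h1 : 0 < spectralMoment κ S 2 0 *
    (spectralMoment κ S 2 0 * rayVar κ S v - rayCov κ S v ^ 2) := by linarith
  linarith [(pos_iff_pos_of_mul_pos h1).1 h0]

end

/-! ### Joint laws -/

/-- A law on `ℝ × ℝ × ℝ` is determined by the characteristic function of linear combinations. -/
lemma map_triple_eq {Ω : Type*} [MeasurableSpace Ω] {μ : Measure Ω} [IsProbabilityMeasure μ]
    {X Y Z : Ω → ℝ} (hX : AEMeasurable X μ) (hY : AEMeasurable Y μ) (hZ : AEMeasurable Z μ)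
    {ν : Measure (ℝ × ℝ × ℝ)} [IsFiniteMeasure ν]
    (h : ∀ a b c : ℝ, ∫ o, Complex.exp (((a * X o + b * Y o + c * Z o : ℝ) : ℂ) * Complex.I) ∂μ =
      ∫ q, Complex.exp (((a * q.1 + b * q.2.1 + c * q.2.2 : ℝ) : ℂ) * Complex.I) ∂ν) :
    μ.map (fun o => (X o, Y o, Z o)) = ν := by
  have hm : AEMeasurable (fun o => (X o, Y o, Z o)) μ := hX.prodMk (hY.prodMk hZ)
  have := Measure.isProbabilityMeasure_map hm
  refine Measure.ext_of_charFunDual ?_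
  ext L
  have hL : ∀ q : ℝ × ℝ × ℝ,
      L q = L (1, 0, 0) * q.1 + L (0, 1, 0) * q.2.1 + L (0, 0, 1) * q.2.2 := fun q => by
    have : q = q.1 • ((1, 0, 0) : ℝ × ℝ × ℝ) + q.2.1 • ((0, 1, 0) : ℝ × ℝ × ℝ)
        + q.2.2 • ((0, 0, 1) : ℝ × ℝ × ℝ) := by ext <;> simp
    conv_lhs => rw [this]
    simp only [map_add, map_smul, smul_eq_mul]
    ring
  rw [charFunDual_apply, charFunDual_apply, integral_map hm (by fun_prop)]
  rw [show (⇑L) = _ from funext hL]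
  exact h _ _ _

lemma integral_exp_gaussianReal (V : ℝ≥0) (a : ℝ) :
    ∫ x, Complex.exp (((a * x : ℝ) : ℂ) * Complex.I) ∂gaussianReal 0 V =
      Complex.exp (-((a ^ 2 * V : ℝ) : ℂ) / 2) := by
  have h := charFun_gaussianReal (μ := 0) (v := V) a
  rw [charFun_apply_real] at h
  simp only [Complex.ofReal_mul]
  rw [h]
  congr 1
  push_cast
  ring

/-- Together with `le_gaussianReal_Ioo`, this squeezes the mass of a short symmetric interval
between its length times the density at an endpoint and at the centre. For `x ≤ 0` the interval is
empty and `ENNReal.ofReal` vanishes, so the sign of the increment needs no case distinction; this is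
where the positive part of `Z_t` comes from. -/
lemma gaussianReal_Ioo_le {V : ℝ≥0} (hV : V ≠ 0) (x : ℝ) :
    gaussianReal 0 V (Ioo (-x) x) ≤ ENNReal.ofReal (2 * x * (√(2 * Real.pi * V))⁻¹) := by
  rw [gaussianReal_apply 0 hV]
  calc ∫⁻ y in Ioo (-x) x, gaussianPDF 0 V y
      ≤ ∫⁻ _ in Ioo (-x) x, ENNReal.ofReal (√(2 * Real.pi * V))⁻¹ := by
        refine lintegral_mono fun y => ENNReal.ofReal_le_ofReal ?_
        rw [gaussianPDFReal]
        exact mul_le_of_le_one_right (by positivity) (Real.exp_le_one_iff.2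
          (div_nonpos_of_nonpos_of_nonneg (neg_nonpos.2 (sq_nonneg _)) (by positivity)))
    _ = ENNReal.ofReal (2 * x * (√(2 * Real.pi * V))⁻¹) := by
        rw [setLIntegral_const, Real.volume_Ioo, ← ENNReal.ofReal_mul (by positivity)]
        congr 1; ring

lemma le_gaussianReal_Ioo {V : ℝ≥0} (hV : V ≠ 0) (x : ℝ) :
    ENNReal.ofReal (2 * x * ((√(2 * Real.pi * V))⁻¹ * Real.exp (-x ^ 2 / (2 * V)))) ≤
      gaussianReal 0 V (Ioo (-x) x) := by
  rw [gaussianReal_apply 0 hV]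
  calc ENNReal.ofReal (2 * x * ((√(2 * Real.pi * V))⁻¹ * Real.exp (-x ^ 2 / (2 * V))))
      = ∫⁻ _ in Ioo (-x) x,
          ENNReal.ofReal ((√(2 * Real.pi * V))⁻¹ * Real.exp (-x ^ 2 / (2 * V))) := by
        rw [setLIntegral_const, Real.volume_Ioo, ← ENNReal.ofReal_mul (by positivity)]
        congr 1; ring
    _ ≤ ∫⁻ y in Ioo (-x) x, gaussianPDF 0 V y := by
        refine setLIntegral_mono (measurable_gaussianPDF 0 V) fun y hy =>
          ENNReal.ofReal_le_ofReal ?_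
        rw [gaussianPDFReal, sub_zero]
        have h1 : y ^ 2 ≤ x ^ 2 := sq_le_sq' hy.1.le hy.2.le
        gcongr

lemma two_pow_mul_ofReal (n : ℕ) (d c : ℝ) :
    2 ^ n * ENNReal.ofReal (2 * (d * dyadicStep n / 2) * c) = ENNReal.ofReal (d * c) := by
  have : (2 : ℝ≥0∞) ^ n = ENNReal.ofReal (2 ^ n) := by
    rw [ENNReal.ofReal_pow two_pos.le, ENNReal.ofReal_ofNat]
  rw [this, ← ENNReal.ofReal_mul (by positivity)]
  congr 1
  unfold dyadicStep
  field_simp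

lemma two_pow_mul_gaussianReal_le {V : ℝ≥0} (hV : V ≠ 0) (n : ℕ) (d : ℝ) :
    2 ^ n * gaussianReal 0 V (Ioo (-(d * dyadicStep n / 2)) (d * dyadicStep n / 2)) ≤
      ENNReal.ofReal (d * (√(2 * Real.pi * V))⁻¹) := by
  rw [← two_pow_mul_ofReal n]
  exact mul_le_mul_right (gaussianReal_Ioo_le hV _) _

lemma le_two_pow_mul_gaussianReal {V : ℝ≥0} (hV : V ≠ 0) (n : ℕ) (d : ℝ) :
    ENNReal.ofReal (d * ((√(2 * Real.pi * V))⁻¹ *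
        Real.exp (-(d * dyadicStep n / 2) ^ 2 / (2 * V)))) ≤
      2 ^ n * gaussianReal 0 V (Ioo (-(d * dyadicStep n / 2)) (d * dyadicStep n / 2)) := by
  rw [← two_pow_mul_ofReal n]
  exact mul_le_mul_right (le_gaussianReal_Ioo hV _) _

section
variable {Ω : Type*} [MeasurableSpace Ω] {μ : Measure Ω} [IsProbabilityMeasure μ]
  {κ : ℝ → ℝ} {S : ℝ × ℝ → ℝ} {W : ℝ × ℝ → Ω → ℝ}

/-! ### Expected marked upcrossings of one interval and their limit -/

lemma IsSpectralDensity.tripleVar_nonneg (hS : IsSpectralDensity S) (v h a b c : ℝ) :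
    0 ≤ tripleVar κ S v h a b c :=
  setIntegral_nonneg measurableSet_spectralDomain fun p hp =>
    mul_nonneg (tripleIntegrand_nonneg ..) (hS.nonneg p hp)

/-- The absence of a cross term between `a` and `(b, c)` says that the mean of the endpoint values
is uncorrelated with both quotients. For Gaussian variables this gives independence. -/
lemma IsSpectralDensity.tripleVar_split (hκ : IsDispersionLaw κ) (hS : IsSpectralDensity S)
    (v h a b c : ℝ) :
    tripleVar κ S v h a b c = a ^ 2 * tripleVar κ S v h 1 0 0 + tripleVar κ S v h 0 b c := by
  rw [tripleVar_eq, tripleVar_eq, tripleVar_eq, ← integral_const_mul,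
    ← integral_add ((hS.integrableOn_tripleIntegrand hκ ..).const_mul _)
      (hS.integrableOn_tripleIntegrand hκ ..)]
  congr 1 with p
  simp only [tripleIntegrand]
  ring

/-- The midpoint value is independent of the symmetric difference quotients, and the joint law
does not depend on the time. -/
lemma IsGaussianSea.map_triple_eq_prod (hκ : IsDispersionLaw κ) (hS : IsSpectralDensity S)
    (hW : IsGaussianSea μ κ S W) (v h t : ℝ) :
    μ.map (fun o => (midValue (W · o) v h t, rayQuotient (W · o) v h t,
        slopeQuotient (W · o) v h t)) =
      (gaussianReal 0 (tripleVar κ S v h 1 0 0).toNNReal).prod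
        (μ.map fun o => (rayQuotient (W · o) v h 0, slopeQuotient (W · o) v h 0)) := by
  have hm : AEMeasurable (fun o => (rayQuotient (W · o) v h 0, slopeQuotient (W · o) v h 0)) μ :=
    (hW.aemeasurable_rayQuotient v h 0).prodMk (hW.aemeasurable_slopeQuotient v h 0)
  have := Measure.isProbabilityMeasure_map hm
  refine map_triple_eq (hW.aemeasurable_midValue v h t) (hW.aemeasurable_rayQuotient v h t)
    (hW.aemeasurable_slopeQuotient v h t) fun a b c => ?_
  rw [hW.integral_exp_triple hκ hS, hS.tripleVar_split hκ]
  have e : ∀ q : ℝ × ℝ × ℝ,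
      Complex.exp (((a * q.1 + b * q.2.1 + c * q.2.2 : ℝ) : ℂ) * Complex.I) =
      Complex.exp (((a * q.1 : ℝ) : ℂ) * Complex.I) *
        Complex.exp (((b * q.2.1 + c * q.2.2 : ℝ) : ℂ) * Complex.I) := fun q => by
    rw [← Complex.exp_add]; congr 1; push_cast; ring
  simp only [e]
  rw [integral_prod_mul (fun x : ℝ => Complex.exp (((a * x : ℝ) : ℂ) * Complex.I))
    (fun q : ℝ × ℝ => Complex.exp (((b * q.1 + c * q.2 : ℝ) : ℂ) * Complex.I)),
    integral_exp_gaussianReal, integral_map hm (by fun_prop)]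
  have h2 := hW.integral_exp_triple hκ hS v h 0 0 b c
  simp only [zero_mul, zero_add] at h2
  rw [h2, ← Complex.exp_add, Real.coe_toNNReal _ (hS.tripleVar_nonneg ..)]
  congr 1
  push_cast
  ring

/-- If `X` is the mean of the endpoint values and `D` the ray quotient, the endpoint values are `X -
D * h / 2` and `X + D * h / 2`, so an upcrossing is the event `|X| < D * h / 2`. As `X` is
independent of the two quotients, it is integrated out by Fubini. -/
lemma IsGaussianSea.lintegral_upcrossing (hκ : IsDispersionLaw κ) (hS : IsSpectralDensity S)
    (hW : IsGaussianSea μ κ S W) (v t : ℝ) {h : ℝ} (hh : 0 < h) {G : ℝ × ℝ → ℝ≥0∞}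
    (hG : Measurable G) :
    ∫⁻ o, {r : ℝ × ℝ | r.1 < 0 ∧ 0 < r.2}.indicator 1
        (encountered W v (t - h / 2) o, encountered W v (t + h / 2) o) *
        G (rayQuotient (W · o) v h t, slopeQuotient (W · o) v h t) ∂μ =
      ∫⁻ o, gaussianReal 0 (tripleVar κ S v h 1 0 0).toNNReal
          (Ioo (-(rayQuotient (W · o) v h 0 * h / 2)) (rayQuotient (W · o) v h 0 * h / 2)) *
        G (rayQuotient (W · o) v h 0, slopeQuotient (W · o) v h 0) ∂μ := by
  set γ := gaussianReal 0 (tripleVar κ S v h 1 0 0).toNNReal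
  have hm3 : AEMeasurable (fun o => (midValue (W · o) v h t, rayQuotient (W · o) v h t,
      slopeQuotient (W · o) v h t)) μ := (hW.aemeasurable_midValue v h t).prodMk
    ((hW.aemeasurable_rayQuotient v h t).prodMk (hW.aemeasurable_slopeQuotient v h t))
  have hm2 : AEMeasurable (fun o => (rayQuotient (W · o) v h 0, slopeQuotient (W · o) v h 0)) μ :=
    (hW.aemeasurable_rayQuotient v h 0).prodMk (hW.aemeasurable_slopeQuotient v h 0)
  let B : Set (ℝ × ℝ × ℝ) := {q | -(q.2.1 * h / 2) < q.1 ∧ q.1 < q.2.1 * h / 2}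
  have hB : MeasurableSet B :=
    (measurableSet_lt (f := fun q : ℝ × ℝ × ℝ => -(q.2.1 * h / 2)) (g := fun q => q.1)
      (by fun_prop) (by fun_prop)).inter
      (measurableSet_lt (f := fun q : ℝ × ℝ × ℝ => q.1) (g := fun q => q.2.1 * h / 2)
        (by fun_prop) (by fun_prop))
  let f : ℝ × ℝ × ℝ → ℝ≥0∞ := fun q => B.indicator 1 q * G q.2
  have hf : Measurable f := (measurable_one.indicator hB).mul (hG.comp measurable_snd)
  calc ∫⁻ o, {r : ℝ × ℝ | r.1 < 0 ∧ 0 < r.2}.indicator 1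
        (encountered W v (t - h / 2) o, encountered W v (t + h / 2) o) *
        G (rayQuotient (W · o) v h t, slopeQuotient (W · o) v h t) ∂μ
      = ∫⁻ o, f (midValue (W · o) v h t, rayQuotient (W · o) v h t,
          slopeQuotient (W · o) v h t) ∂μ := by
        refine lintegral_congr fun o => ?_
        simp only [f]
        congr 1
        have e0 : encountered W v (t - h / 2) o =
            midValue (W · o) v h t - rayQuotient (W · o) v h t * h / 2 := by
          simp only [encountered, midValue, rayQuotient]; field_simp; ring
        have e1 : encountered W v (t + h / 2) o =
            midValue (W · o) v h t + rayQuotient (W · o) v h t * h / 2 := by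
          simp only [encountered, midValue, rayQuotient]; field_simp; ring
        rw [e0, e1]
        refine indicator_eq_indicator ?_ rfl
        show (_ ∧ _) ↔ (_ ∧ _)
        constructor
        · rintro ⟨h1, h2⟩; constructor <;> linarith
        · rintro ⟨h1, h2⟩; constructor <;> linarith
    _ = ∫⁻ q, f q ∂(γ.prod (μ.map fun o =>
          (rayQuotient (W · o) v h 0, slopeQuotient (W · o) v h 0))) := by
        rw [← hW.map_triple_eq_prod hκ hS v h t, lintegral_map' hf.aemeasurable hm3]
    _ = ∫⁻ o, ∫⁻ x, f (x, rayQuotient (W · o) v h 0, slopeQuotient (W · o) v h 0) ∂γ ∂μ := by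
        rw [lintegral_prod_symm' _ hf, lintegral_map' (hf.lintegral_prod_left').aemeasurable hm2]
    _ = _ := by
        refine lintegral_congr fun o => ?_
        simp only [f]
        have hi : Measurable fun x : ℝ => B.indicator (1 : ℝ × ℝ × ℝ → ℝ≥0∞)
            (x, rayQuotient (W · o) v h 0, slopeQuotient (W · o) v h 0) :=
          (measurable_one.indicator hB).comp (by fun_prop)
        rw [lintegral_mul_const _ hi]
        congr 1
        rw [← lintegral_indicator_one measurableSet_Ioo]
        rfl

/-- The density of `Z(0)` at zero. -/
def levelDensity (κ : ℝ → ℝ) (S : ℝ × ℝ → ℝ) : ℝ :=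
  (√(2 * Real.pi * spectralMoment κ S 0 0))⁻¹

lemma levelDensity_pos (hS_pos : 0 < spectralMoment κ S 0 0) : 0 < levelDensity κ S := by
  unfold levelDensity; positivity

lemma IsGaussianSea.tendsto_levelDensity (hκ : IsDispersionLaw κ) (hS : IsSpectralDensity S)
    (hS_pos : 0 < spectralMoment κ S 0 0) (hW : IsGaussianSea μ κ S W) (v : ℝ) :
    Tendsto (fun n => tripleVar κ S v (dyadicStep n) 1 0 0) atTop
        (𝓝 (spectralMoment κ S 0 0)) ∧
      Tendsto (fun n => (√(2 * Real.pi *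
        ((tripleVar κ S v (dyadicStep n) 1 0 0).toNNReal : ℝ)))⁻¹) atTop
        (𝓝 (levelDensity κ S)) := by
  have h1 := hW.tendsto_tripleVar hκ hS v 1 0 0
  rw [hW.integral_limitIntegrand hκ hS] at h1
  simp only [one_pow, one_mul, zero_mul, mul_zero, add_zero, zero_pow two_ne_zero] at h1
  refine ⟨h1, ?_⟩
  simp only [Real.coe_toNNReal _ (hS.tripleVar_nonneg ..)]
  exact ((Real.continuous_sqrt.tendsto _).comp (h1.const_mul (2 * Real.pi))).inv₀ (by positivity)

/-- The expected number of dyadic upcrossings is bounded. -/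
lemma IsGaussianSea.exists_lintegral_upcrossing_le (hκ : IsDispersionLaw κ)
    (hS : IsSpectralDensity S) (hS_pos : 0 < spectralMoment κ S 0 0)
    (hW : IsGaussianSea μ κ S W) (v : ℝ) :
    ∃ C : ℝ, ∀ᶠ n in atTop, 2 ^ n * ∫⁻ o, gaussianReal 0
      (tripleVar κ S v (dyadicStep n) 1 0 0).toNNReal
      (Ioo (-(rayQuotient (W · o) v (dyadicStep n) 0 * dyadicStep n / 2))
        (rayQuotient (W · o) v (dyadicStep n) 0 * dyadicStep n / 2)) ∂μ ≤ ENNReal.ofReal C := by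
  obtain ⟨hV, hc⟩ := hW.tendsto_levelDensity hκ hS hS_pos v
  have hr := hW.tendsto_tripleVar hκ hS v 0 1 0
  set L := levelDensity κ S
  set R := ∫ p in spectralDomain, limitIntegrand κ v 0 1 0 p * S p
  -- Eventually `L + 1` bounds the density at zero of the endpoint mean and `R + 1` the second
  -- moment of the ray quotient `d`; the linear factor is absorbed by `d ≤ 1 + d ^ 2`.
  refine ⟨(L + 1) * (1 + (R + 1)), ?_⟩
  filter_upwards [hV.eventually (lt_mem_nhds hS_pos), hc.eventually (gt_mem_nhds (lt_add_one L)),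
    hr.eventually (gt_mem_nhds (lt_add_one R))] with n hn1 hn2 hn3
  set V := (tripleVar κ S v (dyadicStep n) 1 0 0).toNNReal
  have hV0 : V ≠ 0 := (Real.toNNReal_pos.2 hn1).ne'
  have hL : 0 ≤ L := by unfold L levelDensity; positivity
  have hsq := hW.integral_triple_sq hκ hS v (dyadicStep n) 0 0 1 0
  simp only [zero_mul, one_mul, zero_add, add_zero] at hsq
  have hlp : MemLp (fun o => rayQuotient (W · o) v (dyadicStep n) 0) 2 μ := by
    unfold rayQuotient
    simp only [div_eq_mul_inv]
    exact ((hW.memLp_two _).sub (hW.memLp_two _)).mul_const _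
  have hint : Integrable (fun o => (L + 1) * (1 + rayQuotient (W · o) v (dyadicStep n) 0 ^ 2)) μ :=
    ((integrable_const 1).add hlp.integrable_sq).const_mul _
  rw [← lintegral_const_mul' _ _ (by simp)]
  calc _ ≤ ∫⁻ o, ENNReal.ofReal
        ((L + 1) * (1 + rayQuotient (W · o) v (dyadicStep n) 0 ^ 2)) ∂μ := by
        refine lintegral_mono fun o => ?_
        refine (two_pow_mul_gaussianReal_le hV0 n _).trans (ENNReal.ofReal_le_ofReal ?_)
        set d := rayQuotient (W · o) v (dyadicStep n) 0
        have hc0 : 0 ≤ (√(2 * Real.pi * V))⁻¹ := by positivity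
        calc d * (√(2 * Real.pi * V))⁻¹ ≤ (1 + d ^ 2) * (√(2 * Real.pi * V))⁻¹ :=
              mul_le_mul_of_nonneg_right (by nlinarith [sq_nonneg (d - 1)]) hc0
          _ ≤ (1 + d ^ 2) * (L + 1) := mul_le_mul_of_nonneg_left hn2.le (by positivity)
          _ = (L + 1) * (1 + d ^ 2) := mul_comm _ _
    _ = ENNReal.ofReal ((L + 1) * (1 + tripleVar κ S v (dyadicStep n) 0 1 0)) := by
        rw [← ofReal_integral_eq_lintegral_ofReal hint (ae_of_all _ fun o => by positivity),
          integral_const_mul, integral_add (integrable_const 1) hlp.integrable_sq, hsq]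
        simp
    _ ≤ _ := ENNReal.ofReal_le_ofReal (mul_le_mul_of_nonneg_left (by linarith) (by linarith))

/-- Dominated convergence. The scaled Gaussian mass converges pointwise by the squeeze on short
intervals, and since `G` vanishes for first coordinate above `M`, the integrand is at most the
constant `|M| * (L + 1)`. -/
lemma IsGaussianSea.tendsto_lintegral_upcrossing (hκ : IsDispersionLaw κ)
    (hS : IsSpectralDensity S) (hS_pos : 0 < spectralMoment κ S 0 0)
    (hW : IsGaussianSea μ κ S W) (v : ℝ) {G : ℝ × ℝ → ℝ≥0∞} (hG : Continuous G)
    (hG1 : ∀ q, G q ≤ 1) {M : ℝ} (hM : ∀ q : ℝ × ℝ, M < q.1 → G q = 0) :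
    Tendsto (fun n => 2 ^ n * ∫⁻ o, gaussianReal 0
      (tripleVar κ S v (dyadicStep n) 1 0 0).toNNReal
      (Ioo (-(rayQuotient (W · o) v (dyadicStep n) 0 * dyadicStep n / 2))
        (rayQuotient (W · o) v (dyadicStep n) 0 * dyadicStep n / 2)) *
      G (rayQuotient (W · o) v (dyadicStep n) 0, slopeQuotient (W · o) v (dyadicStep n) 0) ∂μ)
      atTop (𝓝 (∫⁻ o, ENNReal.ofReal (encounteredDeriv W v 0 o * levelDensity κ S) *
        G (encounteredDeriv W v 0 o, slope W (v * 0) 0 o) ∂μ)) := by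
  obtain ⟨hV, hc⟩ := hW.tendsto_levelDensity hκ hS hS_pos v
  set L := levelDensity κ S
  have hL : 0 < L := levelDensity_pos hS_pos
  have hVpos := hV.eventually (lt_mem_nhds hS_pos)
  have hmeas : ∀ (V : ℝ≥0) (n : ℕ), AEMeasurable (fun o => gaussianReal 0 V
      (Ioo (-(rayQuotient (W · o) v (dyadicStep n) 0 * dyadicStep n / 2))
        (rayQuotient (W · o) v (dyadicStep n) 0 * dyadicStep n / 2))) μ := fun V n => by
    have hmono : Monotone fun x : ℝ => gaussianReal 0 V (Ioo (-x) x) := fun x y hxy =>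
      measure_mono (Ioo_subset_Ioo (neg_le_neg hxy) hxy)
    exact hmono.measurable.comp_aemeasurable
      (((hW.aemeasurable_rayQuotient v (dyadicStep n) 0).mul_const _).div_const _)
  refine Tendsto.congr (fun n => lintegral_const_mul' _ _ (by simp)) ?_
  refine tendsto_lintegral_filter_of_dominated_convergence'
    (fun _ => ENNReal.ofReal (|M| * (L + 1))) (Eventually.of_forall fun k => ?_) ?_
    (by simpa using ENNReal.mul_ne_top ENNReal.ofReal_ne_top ENNReal.ofReal_ne_top) ?_
  · exact ((hmeas _ _).mul (hG.measurable.comp_aemeasurable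
      ((hW.aemeasurable_rayQuotient v _ 0).prodMk (hW.aemeasurable_slopeQuotient v _ 0)))).const_mul _
  · filter_upwards [hVpos, hc.eventually (gt_mem_nhds (lt_add_one L))] with n hn1 hn2
    refine ae_of_all _ fun o => ?_
    set d := rayQuotient (W · o) v (dyadicStep n) 0
    by_cases hd : M < d
    · rw [hM _ hd]; simp
    rw [← mul_assoc]
    refine (mul_le_of_le_one_right' (hG1 _)).trans
      ((two_pow_mul_gaussianReal_le (Real.toNNReal_pos.2 hn1).ne' n d).trans
        (ENNReal.ofReal_le_ofReal ?_))
    have hc0 : 0 ≤ (√(2 * Real.pi * ((tripleVar κ S v (dyadicStep n) 1 0 0).toNNReal : ℝ)))⁻¹ := by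
      positivity
    calc d * _ ≤ |M| * _ := mul_le_mul_of_nonneg_right ((not_lt.1 hd).trans (le_abs_self M)) hc0
      _ ≤ |M| * (L + 1) := mul_le_mul_of_nonneg_left hn2.le (abs_nonneg _)
  · filter_upwards [hW.ae_tendsto_triple v 0] with o ⟨_, hD, hY⟩
    simp only [← mul_assoc]
    refine ENNReal.Tendsto.mul ?_ ?_ ((hG.tendsto _).comp (hD.prodMk_nhds hY)) ?_
    · have hx : Tendsto (fun n => rayQuotient (W · o) v (dyadicStep n) 0 * dyadicStep n / 2)
          atTop (𝓝 0) := by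
        simpa using (hD.mul tendsto_dyadicStep).div_const 2
      have hV' : Tendsto (fun n => 2 * ((tripleVar κ S v (dyadicStep n) 1 0 0).toNNReal : ℝ))
          atTop (𝓝 (2 * spectralMoment κ S 0 0)) := by
        simp only [Real.coe_toNNReal _ (hS.tripleVar_nonneg ..)]
        exact hV.const_mul 2
      have he := (Real.continuous_exp.tendsto _).comp
        (((hx.pow 2).neg).div hV' (by positivity))
      simp only [zero_pow two_ne_zero, neg_zero, zero_div, Real.exp_zero] at he
      have hlo := ENNReal.tendsto_ofReal (hD.mul (hc.mul he))
      rw [mul_one] at hlo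
      refine tendsto_of_tendsto_of_tendsto_of_le_of_le' hlo
        (ENNReal.tendsto_ofReal (hD.mul hc)) ?_ ?_
      · filter_upwards [hVpos] with n hn
        exact le_two_pow_mul_gaussianReal (Real.toNNReal_pos.2 hn).ne' n _
      · filter_upwards [hVpos] with n hn
        exact two_pow_mul_gaussianReal_le (Real.toNNReal_pos.2 hn).ne' n _
    · right
      exact ((hG1 _).trans_lt ENNReal.one_lt_top).ne
    · right
      exact ENNReal.ofReal_ne_top

end

/-! ### Rice's formula with marks -/

lemma markedZeros_iSup (z : ℝ → ℝ) {g : ℕ → ℝ → ℝ≥0∞} (hg : Monotone g) :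
    markedZeros z (fun t => ⨆ n, g n t) = ⨆ n, markedZeros z (g n) := by
  unfold markedZeros
  -- For the discrete σ-algebra every function is measurable, so the sum is an integral against
  -- counting measure and monotone convergence applies.
  let : MeasurableSpace ℝ := ⊤
  have hm : Monotone fun n t => {t ∈ Icc (0 : ℝ) 1 | z t = 0}.indicator (g n) t :=
    fun m n hmn t => indicator_le_indicator (hg hmn t)
  simp only [← lintegral_count]
  rw [← lintegral_iSup (fun n => measurable_from_top) hm]
  refine lintegral_congr fun t => ?_
  by_cases ht : t ∈ {t ∈ Icc (0 : ℝ) 1 | z t = 0}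
  · simp only [indicator_of_mem ht]
  · simp only [indicator_of_notMem ht, ENNReal.iSup_zero]

lemma markedZeros_indicator (z : ℝ → ℝ) (s : Set ℝ) :
    markedZeros z (s.indicator 1) = ({t | (t ∈ Icc (0 : ℝ) 1 ∧ z t = 0) ∧ t ∈ s}.encard : ℝ≥0∞) := by
  rw [← ENNReal.tsum_set_one, tsum_subtype _ (fun _ => (1 : ℝ≥0∞))]
  unfold markedZeros
  rw [indicator_indicator]
  rfl

/-- Continuous approximation from below of the indicator of an open set. -/
def innerApprox (U : Set (ℝ × ℝ)) (n : ℕ) (q : ℝ × ℝ) : ℝ≥0∞ :=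
  ENNReal.ofReal (min 1 (max 0 ((n + 1) * Metric.infDist q Uᶜ - 1)) *
    min 1 (max 0 ((n + 1) - q.1)))

lemma continuous_innerApprox (U : Set (ℝ × ℝ)) (n : ℕ) : Continuous (innerApprox U n) := by
  have := Metric.continuous_infDist_pt Uᶜ
  exact ENNReal.continuous_ofReal.comp (by fun_prop)

lemma innerApprox_le_one (U : Set (ℝ × ℝ)) (n : ℕ) (q : ℝ × ℝ) : innerApprox U n q ≤ 1 :=
  ENNReal.ofReal_le_one.2 (mul_le_one₀ (min_le_left _ _) (by positivity) (min_le_left _ _))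

lemma innerApprox_eq_zero_of_gt (U : Set (ℝ × ℝ)) {n : ℕ} {q : ℝ × ℝ} (h : (n + 1 : ℝ) < q.1) :
    innerApprox U n q = 0 := by
  unfold innerApprox
  rw [max_eq_left (a := (0 : ℝ)) (b := (n + 1) - q.1) (by linarith)]
  simp

/-- The set lies in the half-plane of positive first coordinate, so the distance from `q` to its
complement is at most `q.1`, as the point `(0, q.2)` shows. This and `innerApprox_eq_zero_of_gt`
provide the cutoffs `δ` and `M` required of continuous marks. -/
lemma innerApprox_eq_zero_of_lt {U : Set (ℝ × ℝ)} (hU : ∀ q ∈ U, 0 < q.1) {n : ℕ} {q : ℝ × ℝ}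
    (h : q.1 < 1 / (n + 1)) : innerApprox U n q = 0 := by
  have hn : (0 : ℝ) < n + 1 := by positivity
  have hd : Metric.infDist q Uᶜ ≤ 1 / (n + 1) := by
    by_cases hq : q ∈ Uᶜ
    · rw [Metric.infDist_zero_of_mem hq]; positivity
    · have h0 := hU q (not_notMem.1 hq)
      have hmem : ((0, q.2) : ℝ × ℝ) ∈ Uᶜ := fun hc => lt_irrefl _ (hU _ hc)
      refine (Metric.infDist_le_dist_of_mem hmem).trans ?_
      rw [Prod.dist_eq, dist_self, Real.dist_eq, sub_zero, abs_of_pos h0, max_eq_left h0.le]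
      exact h.le
  have : (n + 1) * Metric.infDist q Uᶜ - 1 ≤ 0 := by
    have := mul_le_mul_of_nonneg_left hd hn.le
    rw [mul_one_div_cancel hn.ne'] at this
    linarith
  unfold innerApprox
  rw [max_eq_left this]
  simp

lemma monotone_innerApprox (U : Set (ℝ × ℝ)) : Monotone (innerApprox U) := by
  intro m n hmn q
  have : (m : ℝ) ≤ n := by exact_mod_cast hmn
  have := Metric.infDist_nonneg (x := q) (s := Uᶜ)
  refine ENNReal.ofReal_le_ofReal (mul_le_mul ?_ ?_ (by positivity) (by positivity)) <;> gcongr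

lemma iSup_innerApprox {U : Set (ℝ × ℝ)} (hU : IsOpen U) (hne : Uᶜ.Nonempty) (q : ℝ × ℝ) :
    ⨆ n, innerApprox U n q = U.indicator 1 q := by
  by_cases hq : q ∈ U
  · rw [indicator_of_mem hq, Pi.one_apply]
    refine le_antisymm (iSup_le fun n => innerApprox_le_one U n q) ?_
    have hpos : 0 < Metric.infDist q Uᶜ :=
      (hU.isClosed_compl.notMem_iff_infDist_pos hne).1 (notMem_compl_iff.2 hq)
    -- For such `n` both truncated factors of `innerApprox` have reached the value `1`.
    obtain ⟨n, hn⟩ := exists_nat_ge (max (2 / Metric.infDist q Uᶜ) q.1)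
    refine le_iSup_of_le n ?_
    have h1 : 2 ≤ n * Metric.infDist q Uᶜ := by
      rw [← div_le_iff₀ hpos]; exact (le_max_left _ _).trans hn
    have h2 : q.1 ≤ n := (le_max_right _ _).trans hn
    unfold innerApprox
    rw [min_eq_left, min_eq_left]
    · simp
    · exact le_max_of_le_right (by linarith)
    · exact le_max_of_le_right (by linarith)
  · rw [indicator_of_notMem hq]
    have h0 : Metric.infDist q Uᶜ = 0 := Metric.infDist_zero_of_mem hq
    simp [innerApprox, h0]

section
variable {Ω : Type*} [MeasurableSpace Ω] {μ : Measure Ω}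
  {κ : ℝ → ℝ} {S : ℝ × ℝ → ℝ} {W : ℝ × ℝ → Ω → ℝ}

lemma IsGaussianSea.ae_ne_zero (hW : IsGaussianSea μ κ S W)
    (hS_pos : 0 < spectralMoment κ S 0 0) (x : ℝ × ℝ) : ∀ᵐ o ∂μ, W x o ≠ 0 := by
  have hg := hW.gaussian.hasGaussianLaw_eval x
  have hv := variance_of_integral_eq_zero hg.aemeasurable (hW.mean_zero x)
  have hc := hW.covariance' x x
  have e : ∫ p in spectralDomain, Real.cos (phase κ (x - x) p) * S p = spectralMoment κ S 0 0 := by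
    simp [phase, spectralMoment, momentIntegrand]
  have hV : Var[W x; μ].toNNReal ≠ 0 := by
    rw [hv]
    simp only [sq]
    rw [hc, e]
    exact (Real.toNNReal_pos.2 hS_pos).ne'
  have hna := nullSingletonClass_gaussianReal (μ := ∫ o, W x o ∂μ) hV
  have h0 : μ.map (W x) {0} = 0 := by rw [hg.map_eq_gaussianReal]; exact measure_singleton 0
  rw [Measure.map_apply_of_aemeasurable hg.aemeasurable (measurableSet_singleton 0)] at h0
  rw [ae_iff]
  simp only [ne_eq, not_not]
  exact h0

lemma IsGaussianSea.aemeasurable_upInd (hW : IsGaussianSea μ κ S W) (v : ℝ) (n k : ℕ) :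
    AEMeasurable (fun o => upInd (fun t => encountered W v t o) n k) μ := by
  have hB : MeasurableSet {r : ℝ × ℝ | r.1 < 0 ∧ 0 < r.2} :=
    (measurableSet_lt measurable_fst measurable_const).inter
      (measurableSet_lt measurable_const measurable_snd)
  have h1 : AEMeasurable (fun o => (encountered W v (k / 2 ^ n) o,
      encountered W v ((k + 1) / 2 ^ n) o)) μ :=
    (hW.aemeasurable _).prodMk (hW.aemeasurable _)
  exact (measurable_one.indicator hB).comp_aemeasurable h1

variable [IsProbabilityMeasure μ]

/-- The midpoint of the `k`-th dyadic interval of order `n`. -/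
def dyadicMid (n k : ℕ) : ℝ := (k + 1 / 2) / 2 ^ n

lemma dyadicMid_sub (n k : ℕ) : dyadicMid n k - dyadicStep n / 2 = k / 2 ^ n := by
  unfold dyadicMid dyadicStep; ring

lemma dyadicMid_add (n k : ℕ) : dyadicMid n k + dyadicStep n / 2 = (k + 1) / 2 ^ n := by
  unfold dyadicMid dyadicStep; ring

lemma IsGaussianSea.lintegral_sum_upInd (hκ : IsDispersionLaw κ) (hS : IsSpectralDensity S)
    (hW : IsGaussianSea μ κ S W) (v : ℝ) {G : ℝ × ℝ → ℝ≥0∞} (hG : Measurable G) (n : ℕ) :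
    ∫⁻ o, ∑ k ∈ Finset.range (2 ^ n), upInd (fun t => encountered W v t o) n k *
        G (rayQuotient (W · o) v (dyadicStep n) (dyadicMid n k),
          slopeQuotient (W · o) v (dyadicStep n) (dyadicMid n k)) ∂μ =
      2 ^ n * ∫⁻ o, gaussianReal 0 (tripleVar κ S v (dyadicStep n) 1 0 0).toNNReal
      (Ioo (-(rayQuotient (W · o) v (dyadicStep n) 0 * dyadicStep n / 2))
        (rayQuotient (W · o) v (dyadicStep n) 0 * dyadicStep n / 2)) *
      G (rayQuotient (W · o) v (dyadicStep n) 0, slopeQuotient (W · o) v (dyadicStep n) 0) ∂μ := by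
  have hm : ∀ k, AEMeasurable (fun o => upInd (fun t => encountered W v t o) n k *
        G (rayQuotient (W · o) v (dyadicStep n) (dyadicMid n k),
          slopeQuotient (W · o) v (dyadicStep n) (dyadicMid n k))) μ := fun k =>
    (hW.aemeasurable_upInd v n k).mul (hG.comp_aemeasurable
      ((hW.aemeasurable_rayQuotient v _ _).prodMk (hW.aemeasurable_slopeQuotient v _ _)))
  rw [lintegral_finsetSum' _ fun k _ => hm k]
  have h := fun k => hW.lintegral_upcrossing hκ hS v (dyadicMid n k) (dyadicStep_pos n) hG
  simp only [dyadicMid_sub, dyadicMid_add] at h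
  refine (Finset.sum_congr rfl fun k _ => h k).trans ?_
  simp

/-- Rice's formula for continuous marks which vanish for small and for large derivatives. -/
lemma IsGaussianSea.lintegral_markedZeros (hκ : IsDispersionLaw κ) (hS : IsSpectralDensity S)
    (hS_pos : 0 < spectralMoment κ S 0 0) (hW : IsGaussianSea μ κ S W) (v : ℝ)
    {G : ℝ × ℝ → ℝ≥0∞} (hG : Continuous G) (hG1 : ∀ q, G q ≤ 1) {M : ℝ}
    (hM : ∀ q : ℝ × ℝ, M < q.1 → G q = 0) {δ : ℝ} (hδ : 0 < δ)
    (hGδ : ∀ q : ℝ × ℝ, q.1 < δ → G q = 0) :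
    AEMeasurable (fun o => markedZeros (fun t => encountered W v t o)
        (fun t => G (encounteredDeriv W v t o, slope W (v * t) t o))) μ ∧
      ∫⁻ o, markedZeros (fun t => encountered W v t o)
        (fun t => G (encounteredDeriv W v t o, slope W (v * t) t o)) ∂μ =
      ∫⁻ o, ENNReal.ofReal (encounteredDeriv W v 0 o * levelDensity κ S) *
        G (encounteredDeriv W v 0 o, slope W (v * 0) 0 o) ∂μ := by
  have hne : ∀ᵐ o ∂μ, ∀ n k : ℕ, encountered W v (k / 2 ^ n) o ≠ 0 :=
    ae_all_iff.2 fun n => ae_all_iff.2 fun k => hW.ae_ne_zero hS_pos _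
  let A : ℕ → Ω → ℝ≥0∞ := fun n o =>
    ∑ k ∈ Finset.range (2 ^ n), upInd (fun t => encountered W v t o) n k *
        G (rayQuotient (W · o) v (dyadicStep n) (dyadicMid n k),
          slopeQuotient (W · o) v (dyadicStep n) (dyadicMid n k))
  let B : ℕ → Ω → ℝ≥0∞ := fun n o =>
    ∑ k ∈ Finset.range (2 ^ n), upInd (fun t => encountered W v t o) n k
  have hAm : ∀ n, AEMeasurable (A n) μ := fun n =>
    Finset.aemeasurable_fun_sum _ fun k _ => (hW.aemeasurable_upInd v n k).mul
      (hG.measurable.comp_aemeasurable ((hW.aemeasurable_rayQuotient v _ _).prodMk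
        (hW.aemeasurable_slopeQuotient v _ _)))
  have hBm : ∀ n, AEMeasurable (B n) μ := fun n =>
    Finset.aemeasurable_fun_sum _ fun k _ => hW.aemeasurable_upInd v n k
  have hlim : ∀ᵐ o ∂μ, Tendsto (fun n => A n o) atTop
      (𝓝 (markedZeros (fun t => encountered W v t o)
        (fun t => G (encounteredDeriv W v t o, slope W (v * t) t o)))) := by
    filter_upwards [hne, hW.contDiff] with o ho hC
    refine tendsto_sum_upInd (δ := δ)
      (fun t => (hasDerivAt_ray hC v t).differentiableAt) (continuous_deriv_ray hC v) ho hδ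
      (fun t ht => hGδ _ ht) (fun n k h => hGδ _ ?_) fun t k hk => ?_
    · show rayQuotient (W · o) v (dyadicStep n) (dyadicMid n k) < δ
      unfold rayQuotient
      rw [dyadicMid_sub, dyadicMid_add, div_lt_iff₀ (dyadicStep_pos n)]
      simpa [dyadicStep, div_eq_mul_inv] using h
    · exact (hG.tendsto _).comp
        ((tendsto_rayQuotient hC v tendsto_dyadicStep hk dyadicStep_ne_zero).prodMk_nhds
          (tendsto_slopeQuotient hC v tendsto_dyadicStep hk dyadicStep_ne_zero))
  refine ⟨aemeasurable_of_tendsto_metrizable_ae' hAm hlim, ?_⟩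
  -- The unmarked counts `B n` dominate `A n`, increase in `n` and have bounded expectations, so
  -- their supremum is an integrable majorant.
  have hBmono : ∀ᵐ o ∂μ, Monotone fun n => B n o := by
    filter_upwards [hne] with o ho
    exact monotone_nat_of_le_succ fun n => sum_upInd_le_succ ho n
  have hBint : ∀ n, ∫⁻ o, B n o ∂μ = 2 ^ n * ∫⁻ o, gaussianReal 0
      (tripleVar κ S v (dyadicStep n) 1 0 0).toNNReal
      (Ioo (-(rayQuotient (W · o) v (dyadicStep n) 0 * dyadicStep n / 2))
        (rayQuotient (W · o) v (dyadicStep n) 0 * dyadicStep n / 2)) ∂μ := fun n => by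
    simpa using hW.lintegral_sum_upInd hκ hS v (G := fun _ => 1) measurable_const n
  obtain ⟨C, hC⟩ := hW.exists_lintegral_upcrossing_le hκ hS hS_pos v
  have hBfin : ∫⁻ o, ⨆ n, B n o ∂μ ≠ ⊤ := by
    rw [lintegral_iSup' hBm hBmono]
    refine ((iSup_le fun n => ?_).trans_lt (ENNReal.ofReal_lt_top (r := C))).ne
    obtain ⟨m, hm, hnm⟩ := (hC.and (eventually_ge_atTop n)).exists
    rw [← hBint] at hm
    exact (lintegral_mono_ae (hBmono.mono fun o ho => ho hnm)).trans hm
  have hAlim := tendsto_lintegral_of_dominated_convergence' (fun o => ⨆ n, B n o) hAm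
    (fun n => ae_of_all _ fun o => (Finset.sum_le_sum fun k _ =>
      mul_le_of_le_one_right' (hG1 _)).trans (le_iSup (fun n => B n o) n)) hBfin hlim
  refine tendsto_nhds_unique hAlim ?_
  refine (hW.tendsto_lintegral_upcrossing hκ hS hS_pos v hG hG1 hM).congr fun n => ?_
  exact (hW.lintegral_sum_upInd hκ hS v hG.measurable n).symm

/-- Rice's formula for marks in an open set. -/
lemma IsGaussianSea.lintegral_encard (hκ : IsDispersionLaw κ) (hS : IsSpectralDensity S)
    (hS_pos : 0 < spectralMoment κ S 0 0) (hW : IsGaussianSea μ κ S W) (v : ℝ)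
    {U : Set (ℝ × ℝ)} (hU : IsOpen U) (hU0 : ∀ q ∈ U, 0 < q.1) :
    AEMeasurable (fun o => ({t | (t ∈ Icc (0 : ℝ) 1 ∧ encountered W v t o = 0) ∧
        (encounteredDeriv W v t o, slope W (v * t) t o) ∈ U}.encard : ℝ≥0∞)) μ ∧
      ∫⁻ o, ({t | (t ∈ Icc (0 : ℝ) 1 ∧ encountered W v t o = 0) ∧
        (encounteredDeriv W v t o, slope W (v * t) t o) ∈ U}.encard : ℝ≥0∞) ∂μ =
      ∫⁻ o, ENNReal.ofReal (encounteredDeriv W v 0 o * levelDensity κ S) *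
        U.indicator 1 (encounteredDeriv W v 0 o, slope W (v * 0) 0 o) ∂μ := by
  have hne : Uᶜ.Nonempty := ⟨(0, 0), fun h => lt_irrefl _ (hU0 _ h)⟩
  have key := fun n => hW.lintegral_markedZeros hκ hS hS_pos v (continuous_innerApprox U n)
    (innerApprox_le_one U n) (fun q => innerApprox_eq_zero_of_gt U)
    (show (0 : ℝ) < 1 / (n + 1) by positivity) (fun q => innerApprox_eq_zero_of_lt hU0)
  have e : ∀ o, ({t | (t ∈ Icc (0 : ℝ) 1 ∧ encountered W v t o = 0) ∧
        (encounteredDeriv W v t o, slope W (v * t) t o) ∈ U}.encard : ℝ≥0∞) =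
      ⨆ n, markedZeros (fun t => encountered W v t o)
        (fun t => innerApprox U n (encounteredDeriv W v t o, slope W (v * t) t o)) := fun o => by
    have hm : Monotone fun n t =>
        innerApprox U n (encounteredDeriv W v t o, slope W (v * t) t o) :=
      fun m n hmn t => monotone_innerApprox U hmn _
    rw [← markedZeros_iSup _ hm]
    simp only [iSup_innerApprox hU hne]
    exact (markedZeros_indicator (fun t => encountered W v t o)
      {t | (encounteredDeriv W v t o, slope W (v * t) t o) ∈ U}).symm
  have hmono : ∀ o, Monotone fun n => markedZeros (fun t => encountered W v t o)
        (fun t => innerApprox U n (encounteredDeriv W v t o, slope W (v * t) t o)) :=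
    fun o m n hmn => ENNReal.tsum_le_tsum fun t =>
      indicator_le_indicator (monotone_innerApprox U hmn _)
  simp only [e]
  refine ⟨AEMeasurable.iSup fun n => (key n).1, ?_⟩
  have hv := hW.aemeasurable_encounteredDeriv v 0
  have hs := hW.aemeasurable_slope v 0
  rw [lintegral_iSup' (fun n => (key n).1) (ae_of_all _ hmono)]
  simp only [(key _).2]
  have hm : ∀ n, AEMeasurable (fun o => ENNReal.ofReal (encounteredDeriv W v 0 o *
      levelDensity κ S) * innerApprox U n (encounteredDeriv W v 0 o, slope W (v * 0) 0 o)) μ :=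
    fun n => ((hv.mul_const _).ennreal_ofReal).mul
      ((continuous_innerApprox U n).measurable.comp_aemeasurable (hv.prodMk hs))
  rw [← lintegral_iSup' hm
    (ae_of_all _ fun o m n hmn => mul_le_mul_right (monotone_innerApprox U hmn _) _)]
  simp only [← ENNReal.mul_iSup, iSup_innerApprox hU hne]

end

/-! ### Gaussian integrals -/

lemma gaussianPDFReal_zero_one (x : ℝ) :
    gaussianPDFReal 0 1 x = (√(2 * Real.pi))⁻¹ * Real.exp (-x ^ 2 / 2) := by
  simp [gaussianPDFReal]

lemma continuous_gaussianPDFReal (m : ℝ) (v : ℝ≥0) : Continuous (gaussianPDFReal m v) := by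
  rw [gaussianPDFReal_def]
  fun_prop

lemma hasDerivAt_gaussianPDFReal (x : ℝ) :
    HasDerivAt (gaussianPDFReal 0 1) (-x * gaussianPDFReal 0 1 x) x := by
  have h : HasDerivAt (fun y : ℝ => -y ^ 2 / 2) (-x) x := by
    have := (((hasDerivAt_id x).pow 2).neg).div_const 2
    refine this.congr_deriv ?_
    simp
    ring
  rw [show gaussianPDFReal 0 1 = _ from funext gaussianPDFReal_zero_one]
  exact (h.exp.const_mul _).congr_deriv (by ring)

lemma tendsto_gaussianPDFReal_atTop : Tendsto (gaussianPDFReal 0 1) atTop (𝓝 0) := by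
  rw [show gaussianPDFReal 0 1 = _ from funext gaussianPDFReal_zero_one]
  have h : Tendsto (fun y : ℝ => -y ^ 2 / 2) atTop atBot := by
    have := ((tendsto_pow_atTop (α := ℝ) two_ne_zero).atTop_div_const two_pos)
    refine (tendsto_neg_atTop_atBot.comp this).congr fun y => ?_
    simp [neg_div]
  simpa using (Real.tendsto_exp_atBot.comp h).const_mul (√(2 * Real.pi))⁻¹

lemma stdNormalCDF_eq_integral (x : ℝ) :
    stdNormalCDF x = ∫ y in Iic x, gaussianPDFReal 0 1 y := by
  rw [stdNormalCDF, cdf_eq_real, measureReal_def, gaussianReal_apply_eq_integral _ one_ne_zero,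
    ENNReal.toReal_ofReal (integral_nonneg fun y => gaussianPDFReal_nonneg ..)]

lemma hasDerivAt_stdNormalCDF (x : ℝ) :
    HasDerivAt stdNormalCDF (gaussianPDFReal 0 1 x) x := by
  have hi := integrable_gaussianPDFReal 0 1
  have h : ∀ y, stdNormalCDF y =
      stdNormalCDF 0 + ∫ u in (0 : ℝ)..y, gaussianPDFReal 0 1 u := fun y => by
    rw [stdNormalCDF_eq_integral, stdNormalCDF_eq_integral,
      ← intervalIntegral.integral_Iic_sub_Iic hi.integrableOn hi.integrableOn]
    ring
  rw [show stdNormalCDF = _ from funext h]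
  exact (intervalIntegral.integral_hasDerivAt_right hi.intervalIntegrable
    (continuous_gaussianPDFReal 0 1).stronglyMeasurable.stronglyMeasurableAtFilter
    (continuous_gaussianPDFReal 0 1).continuousAt).const_add _

lemma stdNormalCDF_neg (x : ℝ) : stdNormalCDF (-x) = 1 - stdNormalCDF x := by
  have : NullSingletonClass (gaussianReal 0 1) := nullSingletonClass_gaussianReal one_ne_zero
  rw [stdNormalCDF, stdNormalCDF, cdf_eq_real, cdf_eq_real, ← probReal_compl_eq_one_sub
    measurableSet_Iic, compl_Iic, ← measureReal_congr (Ioi_ae_eq_Ici (μ := gaussianReal 0 1)).symm]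
  have h := gaussianReal_map_neg (μ := 0) (v := 1)
  rw [neg_zero] at h
  conv_lhs => rw [← h]
  rw [map_measureReal_apply measurable_neg measurableSet_Iic]
  congr 1
  ext y
  simp

lemma stdNormalCDF_zero : stdNormalCDF 0 = 1 / 2 := by
  have := stdNormalCDF_neg 0
  rw [neg_zero] at this
  linarith

lemma stdNormalCDF_nonneg (x : ℝ) : 0 ≤ stdNormalCDF x := cdf_nonneg _ x

lemma stdNormalCDF_le_one (x : ℝ) : stdNormalCDF x ≤ 1 := cdf_le_one _ x

lemma tendsto_stdNormalCDF_atTop : Tendsto stdNormalCDF atTop (𝓝 1) := tendsto_cdf_atTop _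

lemma tendsto_stdNormalCDF_atBot : Tendsto stdNormalCDF atBot (𝓝 0) := tendsto_cdf_atBot _

/-! ### The mean positive part and its integral against the slope density -/

/-- The mean of the positive part of a Gaussian variable with mean `m` and standard
deviation `τ`. -/
def posPartMean (τ m : ℝ) : ℝ :=
  m * stdNormalCDF (m / τ) + τ * gaussianPDFReal 0 1 (m / τ)

lemma gaussianPDFReal_eq_div {τ : ℝ} (hτ : 0 < τ) {V : ℝ≥0} (hV : (V : ℝ) = τ ^ 2) (m z : ℝ) :
    gaussianPDFReal m V z = gaussianPDFReal 0 1 ((z - m) / τ) / τ := by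
  rw [gaussianPDFReal_zero_one, gaussianPDFReal, hV, Real.sqrt_mul (by positivity),
    Real.sqrt_sq hτ.le]
  have : -((z - m) / τ) ^ 2 / 2 = -(z - m) ^ 2 / (2 * τ ^ 2) := by field_simp
  rw [this]
  field_simp

lemma integral_Ioi_mul_gaussianPDFReal {τ : ℝ} (hτ : 0 < τ) {V : ℝ≥0} (hV : (V : ℝ) = τ ^ 2)
    (m : ℝ) : IntegrableOn (fun z => z * gaussianPDFReal m V z) (Ioi 0) ∧
      ∫ z in Ioi 0, z * gaussianPDFReal m V z = posPartMean τ m := by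
  -- An antiderivative of the integrand, found by writing `z = m + (z - m)`; the second term
  -- integrates to a multiple of the density.
  let g : ℝ → ℝ := fun z =>
    m * stdNormalCDF ((z - m) / τ) - τ * gaussianPDFReal 0 1 ((z - m) / τ)
  have hd : ∀ z, HasDerivAt g (z * gaussianPDFReal m V z) z := fun z => by
    have h0 : HasDerivAt (fun z => (z - m) / τ) (1 / τ) z :=
      ((hasDerivAt_id z).sub_const m).div_const τ
    have h1 := ((hasDerivAt_stdNormalCDF ((z - m) / τ)).comp z h0).const_mul m
    have h2 := ((hasDerivAt_gaussianPDFReal ((z - m) / τ)).comp z h0).const_mul τ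
    refine (h1.sub h2).congr_deriv ?_
    rw [gaussianPDFReal_eq_div hτ hV]
    field_simp
    ring
  have hlim : Tendsto (fun z => (z - m) / τ) atTop atTop :=
    (tendsto_atTop_add_const_right _ (-m) tendsto_id).atTop_div_const hτ
  have ht : Tendsto g atTop (𝓝 m) := by
    simpa using ((tendsto_stdNormalCDF_atTop.comp hlim).const_mul m).sub
      ((tendsto_gaussianPDFReal_atTop.comp hlim).const_mul τ)
  have hp : ∀ z ∈ Ioi (0 : ℝ), 0 ≤ z * gaussianPDFReal m V z := fun z hz =>
    mul_nonneg (le_of_lt hz) (gaussianPDFReal_nonneg ..)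
  refine ⟨integrableOn_Ioi_deriv_of_nonneg' (fun z _ => hd z) hp ht, ?_⟩
  rw [integral_Ioi_of_hasDerivAt_of_nonneg' (fun z _ => hd z) hp ht]
  simp only [g, posPartMean, zero_sub, neg_div, stdNormalCDF_neg, gaussianPDFReal_zero_one,
    neg_sq]
  ring

lemma posPartMean_nonneg {τ : ℝ} (hτ : 0 < τ) (m : ℝ) : 0 ≤ posPartMean τ m := by
  rw [← (integral_Ioi_mul_gaussianPDFReal hτ (V := ⟨τ ^ 2, sq_nonneg τ⟩) rfl m).2]
  exact setIntegral_nonneg measurableSet_Ioi fun z hz =>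
    mul_nonneg (le_of_lt hz) (gaussianPDFReal_nonneg ..)

lemma lintegral_mul_gaussianPDF {τ : ℝ} (hτ : 0 < τ) {V : ℝ≥0} (hV : (V : ℝ) = τ ^ 2) (m : ℝ) :
    ∫⁻ z, ENNReal.ofReal z * gaussianPDF m V z = ENNReal.ofReal (posPartMean τ m) := by
  obtain ⟨hi, he⟩ := integral_Ioi_mul_gaussianPDFReal hτ hV m
  rw [← he, ofReal_integral_eq_lintegral_ofReal hi
    ((ae_restrict_mem measurableSet_Ioi).mono fun z hz =>
      mul_nonneg (le_of_lt hz) (gaussianPDFReal_nonneg ..)),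
    ← lintegral_indicator measurableSet_Ioi]
  refine lintegral_congr fun z => ?_
  by_cases hz : 0 < z
  · rw [indicator_of_mem (show z ∈ Ioi 0 from hz), ENNReal.ofReal_mul hz.le]; rfl
  · rw [indicator_of_notMem (show z ∉ Ioi 0 from hz), ENNReal.ofReal_of_nonpos (not_lt.1 hz),
      zero_mul]

lemma lintegral_Iic_of_hasDerivAt_of_nonneg {g g' : ℝ → ℝ} (hg : ∀ x, HasDerivAt g (g' x) x)
    (hpos : ∀ x, 0 ≤ g' x) (hlim : Tendsto g atBot (𝓝 0)) (w : ℝ) :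
    ∫⁻ x in Iic w, ENNReal.ofReal (g' x) = ENNReal.ofReal (g w) := by
  -- Reflection to an upper half-line, where a nonnegative derivative of a function with a limit at
  -- infinity is integrable.
  have hd : ∀ x, HasDerivAt (fun x => -g (-x)) (g' (-x)) x := fun x =>
    ((hg (-x)).comp x (hasDerivAt_neg x)).neg.congr_deriv (by simp)
  have ht : Tendsto (fun x => -g (-x)) atTop (𝓝 0) := by
    simpa using (hlim.comp tendsto_neg_atTop_atBot).neg
  have hi := integrableOn_Ioi_deriv_of_nonneg' (a := -w) (fun x _ => hd x) (fun x _ => hpos _) ht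
  have hi' : IntegrableOn g' (Iic w) := by
    rw [integrableOn_Iic_iff_integrableOn_Iio]
    simpa using hi.comp_neg_Iio
  rw [← ofReal_integral_eq_lintegral_ofReal hi' (ae_of_all _ hpos),
    integral_Iic_of_hasDerivAt_of_tendsto' (fun x _ => hg x) hi' hlim, sub_zero]

/-- The antiderivative of `√(2π)` times the density of the slope at upcrossings. -/
def slopePrimitive (l τ β y : ℝ) : ℝ :=
  √(τ ^ 2 + β ^ 2 * l ^ 2) * stdNormalCDF (√(τ ^ 2 + β ^ 2 * l ^ 2) / (l * τ) * y)
    - β * l * Real.exp (-y ^ 2 / (2 * l ^ 2)) * stdNormalCDF (β / τ * y)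

/-- With `s ^ 2 = τ ^ 2 + β ^ 2 * l ^ 2`, one has `s ^ 2 / (l * τ) ^ 2 = 1 / l ^ 2 + (β / τ) ^ 2`,
so the density at `s * y / (l * τ)` is `exp (-y ^ 2 / (2 * l ^ 2))` times the density at `β * y /
τ`. The two terms carrying a density then combine with coefficient `s ^ 2 / (l * τ) - β ^ 2 * l / τ
= τ / l`, which is the density part of `posPartMean`. Differentiating the exponential yields its `Φ`
part. -/
lemma hasDerivAt_slopePrimitive {l τ : ℝ} (hl : 0 < l) (hτ : 0 < τ) (β : ℝ) {V : ℝ≥0}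
    (hV : (V : ℝ) = l ^ 2) (y : ℝ) : HasDerivAt (slopePrimitive l τ β)
      (√(2 * Real.pi) * (posPartMean τ (β * y) * gaussianPDFReal 0 V y)) y := by
  set s := √(τ ^ 2 + β ^ 2 * l ^ 2) with hs
  have hs2 : s ^ 2 = τ ^ 2 + β ^ 2 * l ^ 2 := Real.sq_sqrt (by positivity)
  have hlin : ∀ c : ℝ, HasDerivAt (fun y => c * y) c y := fun c => by
    simpa using (hasDerivAt_id y).const_mul c
  have h1 := ((hasDerivAt_stdNormalCDF _).comp y (hlin (s / (l * τ)))).const_mul s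
  have h2 := (hasDerivAt_stdNormalCDF _).comp y (hlin (β / τ))
  have h3 : HasDerivAt (fun y : ℝ => -y ^ 2 / (2 * l ^ 2)) (-y / l ^ 2) y := by
    have := (((hasDerivAt_id y).pow 2).neg).div_const (2 * l ^ 2)
    refine this.congr_deriv ?_
    simp
    field_simp
  refine (h1.sub ((h3.exp.const_mul (β * l)).mul h2)).congr_deriv ?_
  rw [gaussianPDFReal_eq_div hl hV, posPartMean]
  have e1 : gaussianPDFReal 0 1 (s / (l * τ) * y) =
      Real.exp (-y ^ 2 / (2 * l ^ 2)) * gaussianPDFReal 0 1 (β / τ * y) := by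
    rw [gaussianPDFReal_zero_one, gaussianPDFReal_zero_one, mul_left_comm, ← Real.exp_add]
    congr 2
    field_simp
    rw [hs2]
    ring
  have e2 : gaussianPDFReal 0 1 ((y - 0) / l) =
      (√(2 * Real.pi))⁻¹ * Real.exp (-y ^ 2 / (2 * l ^ 2)) := by
    rw [gaussianPDFReal_zero_one, sub_zero]
    congr 2
    field_simp
  have e3 : β * y / τ = β / τ * y := by ring
  have hpi : √(2 * Real.pi) ≠ 0 := by positivity
  rw [e1, e2, e3]
  simp only [Function.comp]
  generalize gaussianPDFReal 0 1 (β / τ * y) = p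
  generalize stdNormalCDF (β / τ * y) = P
  generalize Real.exp (-y ^ 2 / (2 * l ^ 2)) = E
  generalize √(2 * Real.pi) = c at hpi
  field_simp
  linear_combination (E * p) * hs2

lemma tendsto_slopePrimitive {l τ : ℝ} (hl : 0 < l) (hτ : 0 < τ) (β : ℝ) :
    Tendsto (slopePrimitive l τ β) atBot (𝓝 0) := by
  have ha : 0 < √(τ ^ 2 + β ^ 2 * l ^ 2) / (l * τ) := by positivity
  have h1 := (tendsto_stdNormalCDF_atBot.comp (tendsto_id.const_mul_atBot ha)).const_mul
    √(τ ^ 2 + β ^ 2 * l ^ 2)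
  have h2 : Tendsto (fun y : ℝ => Real.exp (-y ^ 2 / (2 * l ^ 2))) atBot (𝓝 0) := by
    refine Real.tendsto_exp_atBot.comp ?_
    have := (((tendsto_pow_atTop (α := ℝ) two_ne_zero).comp tendsto_neg_atBot_atTop).atTop_div_const
      (show 0 < 2 * l ^ 2 by positivity))
    refine (tendsto_neg_atTop_atBot.comp this).congr fun y => ?_
    simp [neg_div]
  have h3 : Tendsto (fun y => β * l * Real.exp (-y ^ 2 / (2 * l ^ 2)) * stdNormalCDF (β / τ * y))
      atBot (𝓝 0) := by
    refine squeeze_zero_norm (a := fun y => |β * l| * Real.exp (-y ^ 2 / (2 * l ^ 2)))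
      (fun y => ?_) (by simpa using h2.const_mul |β * l|)
    rw [Real.norm_eq_abs, abs_mul, abs_mul, Real.abs_exp, abs_of_nonneg (stdNormalCDF_nonneg _)]
    exact mul_le_of_le_one_right (by positivity) (stdNormalCDF_le_one _)
  have h := h1.sub h3
  rw [mul_zero, sub_zero] at h
  exact h

lemma lintegral_posPartMean_Iic {l τ : ℝ} (hl : 0 < l) (hτ : 0 < τ) (β : ℝ) {V : ℝ≥0}
    (hV : (V : ℝ) = l ^ 2) (w : ℝ) :
    ∫⁻ y in Iic w, ENNReal.ofReal (posPartMean τ (β * y)) * gaussianPDF 0 V y =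
      ENNReal.ofReal ((√(2 * Real.pi))⁻¹ * slopePrimitive l τ β w) := by
  have hpi : √(2 * Real.pi) ≠ 0 := by positivity
  rw [← lintegral_Iic_of_hasDerivAt_of_nonneg
    (g := fun y => (√(2 * Real.pi))⁻¹ * slopePrimitive l τ β y)
    (fun y => (hasDerivAt_slopePrimitive hl hτ β hV y).const_mul _) (fun y => ?_)
    (by simpa using (tendsto_slopePrimitive hl hτ β).const_mul (√(2 * Real.pi))⁻¹)]
  · refine lintegral_congr fun y => ?_
    rw [inv_mul_cancel_left₀ hpi, ENNReal.ofReal_mul (posPartMean_nonneg hτ _)]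
    rfl
  · rw [inv_mul_cancel_left₀ hpi]
    exact mul_nonneg (posPartMean_nonneg hτ _) (gaussianPDFReal_nonneg ..)

lemma slopePrimitive_zero (l τ β : ℝ) :
    slopePrimitive l τ β 0 = (√(τ ^ 2 + β ^ 2 * l ^ 2) - β * l) / 2 := by
  simp [slopePrimitive, stdNormalCDF_zero]
  ring

/-! ### The joint density -/

/-- The density of `(X, R + β Y, Y)` for independent centred Gaussian variables `X`, `R`, `Y` with
variances `v₀`, `v₁`, `v₂`. -/
def shearDensity (v₀ v₁ v₂ : ℝ≥0) (β : ℝ) (q : ℝ × ℝ × ℝ) : ℝ :=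
  gaussianPDFReal 0 v₀ q.1 *
    (gaussianPDFReal (β * q.2.2) v₁ q.2.1 * gaussianPDFReal 0 v₂ q.2.2)

lemma shearDensity_nonneg (v₀ v₁ v₂ : ℝ≥0) (β : ℝ) (q : ℝ × ℝ × ℝ) :
    0 ≤ shearDensity v₀ v₁ v₂ β q :=
  mul_nonneg (gaussianPDFReal_nonneg ..)
    (mul_nonneg (gaussianPDFReal_nonneg ..) (gaussianPDFReal_nonneg ..))

lemma continuous_shearDensity (v₀ v₁ v₂ : ℝ≥0) (β : ℝ) : Continuous (shearDensity v₀ v₁ v₂ β) := by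
  unfold shearDensity gaussianPDFReal
  fun_prop

lemma lintegral_gaussianReal (m : ℝ) {V : ℝ≥0} (hV : V ≠ 0) {g : ℝ → ℝ≥0∞} (hg : Measurable g) :
    ∫⁻ x, g x ∂gaussianReal m V = ∫⁻ x, gaussianPDF m V x * g x := by
  rw [gaussianReal_of_var_ne_zero _ hV,
    lintegral_withDensity_eq_lintegral_mul _ (measurable_gaussianPDF m V) hg]
  rfl

lemma lintegral_withDensity_shearDensity (v₀ v₁ v₂ : ℝ≥0) (β : ℝ) {g : ℝ × ℝ × ℝ → ℝ≥0∞}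
    (hg : Measurable g) :
    ∫⁻ q, g q ∂(volume.withDensity fun q => ENNReal.ofReal (shearDensity v₀ v₁ v₂ β q)) =
      ∫⁻ x, gaussianPDF 0 v₀ x *
        ∫⁻ y, gaussianPDF 0 v₂ y * ∫⁻ z, gaussianPDF (β * y) v₁ z * g (x, z, y) := by
  have hf : Measurable fun q => ENNReal.ofReal (shearDensity v₀ v₁ v₂ β q) :=
    (continuous_shearDensity ..).measurable.ennreal_ofReal
  rw [lintegral_withDensity_eq_lintegral_mul _ hf hg, Measure.volume_eq_prod,
    lintegral_prod _ (hf.mul hg).aemeasurable]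
  refine lintegral_congr fun x => ?_
  have hx : Measurable fun q : ℝ × ℝ => ((fun q => ENNReal.ofReal (shearDensity v₀ v₁ v₂ β q)) * g)
      (x, q) := (hf.mul hg).comp measurable_prodMk_left
  rw [Measure.volume_eq_prod, lintegral_prod_symm' _ hx,
    ← lintegral_const_mul' _ _ gaussianPDF_ne_top]
  refine lintegral_congr fun y => ?_
  rw [← mul_assoc, ← lintegral_const_mul' _ _ (ENNReal.mul_ne_top gaussianPDF_ne_top
    gaussianPDF_ne_top)]
  refine lintegral_congr fun z => ?_
  simp only [Pi.mul_apply, shearDensity, gaussianPDF]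
  rw [ENNReal.ofReal_mul (gaussianPDFReal_nonneg ..),
    ENNReal.ofReal_mul (gaussianPDFReal_nonneg ..)]
  ring

/-- For fixed third coordinate `y`, the shear translates the second coordinate by `β * y`, which
turns a centred Gaussian law into one with mean `β * y`. -/
lemma withDensity_shearDensity_eq_map {v₀ v₁ v₂ : ℝ≥0} (h₀ : v₀ ≠ 0) (h₁ : v₁ ≠ 0) (h₂ : v₂ ≠ 0)
    (β : ℝ) :
    volume.withDensity (fun q => ENNReal.ofReal (shearDensity v₀ v₁ v₂ β q)) =
      ((gaussianReal 0 v₀).prod ((gaussianReal 0 v₁).prod (gaussianReal 0 v₂))).map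
        (fun q => (q.1, q.2.1 + β * q.2.2, q.2.2)) := by
  have hT : Measurable fun q : ℝ × ℝ × ℝ => (q.1, q.2.1 + β * q.2.2, q.2.2) := by fun_prop
  refine Measure.ext_of_lintegral _ fun g hg => ?_
  have hgT : Measurable fun q : ℝ × ℝ × ℝ => g (q.1, q.2.1 + β * q.2.2, q.2.2) := hg.comp hT
  rw [lintegral_withDensity_shearDensity _ _ _ _ hg, lintegral_map hg hT,
    lintegral_prod _ hgT.aemeasurable]
  have hm : ∀ x : ℝ, Measurable fun q : ℝ × ℝ => g (x, q.1 + β * q.2, q.2) := fun x =>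
    hg.comp (by fun_prop)
  have hin : ∀ x y : ℝ, ∫⁻ r, g (x, r + β * y, y) ∂gaussianReal 0 v₁ =
      ∫⁻ z, gaussianPDF (β * y) v₁ z * g (x, z, y) := fun x y => by
    have hxy : Measurable fun z : ℝ => g (x, z, y) := hg.comp (by fun_prop)
    rw [← lintegral_gaussianReal _ h₁ hxy]
    have := gaussianReal_map_add_const (μ := 0) (v := v₁) (β * y)
    rw [zero_add] at this
    rw [← this, lintegral_map hxy (measurable_add_const _)]
  have hmid : ∀ x : ℝ, ∫⁻ q, g (x, q.1 + β * q.2, q.2)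
      ∂((gaussianReal 0 v₁).prod (gaussianReal 0 v₂)) =
      ∫⁻ y, gaussianPDF 0 v₂ y * ∫⁻ z, gaussianPDF (β * y) v₁ z * g (x, z, y) := fun x => by
    rw [lintegral_prod_symm' _ (hm x), ← lintegral_gaussianReal 0 h₂]
    · simp only [hin]
    · simp only [← hin]
      exact (hm x).lintegral_prod_left'
  rw [← lintegral_gaussianReal 0 h₀]
  · simp only [hmid]
  · simp only [← hmid]
    exact hgT.lintegral_prod_right'

lemma integral_exp_shearDensity {v₀ v₁ v₂ : ℝ≥0} (h₀ : v₀ ≠ 0) (h₁ : v₁ ≠ 0) (h₂ : v₂ ≠ 0)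
    (β a b c : ℝ) :
    ∫ q, Complex.exp (((a * q.1 + b * q.2.1 + c * q.2.2 : ℝ) : ℂ) * Complex.I)
        ∂(volume.withDensity fun q => ENNReal.ofReal (shearDensity v₀ v₁ v₂ β q)) =
      Complex.exp (-((a ^ 2 * v₀ + b ^ 2 * v₁ + (b * β + c) ^ 2 * v₂ : ℝ) : ℂ) / 2) := by
  rw [withDensity_shearDensity_eq_map h₀ h₁ h₂, integral_map (by fun_prop) (by fun_prop)]
  have e : ∀ q : ℝ × ℝ × ℝ,
      Complex.exp (((a * q.1 + b * (q.2.1 + β * q.2.2) + c * q.2.2 : ℝ) : ℂ) * Complex.I) =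
      Complex.exp (((a * q.1 : ℝ) : ℂ) * Complex.I) *
        (Complex.exp (((b * q.2.1 : ℝ) : ℂ) * Complex.I) *
          Complex.exp ((((b * β + c) * q.2.2 : ℝ) : ℂ) * Complex.I)) := fun q => by
    rw [← Complex.exp_add, ← Complex.exp_add]; congr 1; push_cast; ring
  simp only [e]
  rw [integral_prod_mul (fun x : ℝ => Complex.exp (((a * x : ℝ) : ℂ) * Complex.I))
    (fun q : ℝ × ℝ => Complex.exp (((b * q.1 : ℝ) : ℂ) * Complex.I) *
          Complex.exp ((((b * β + c) * q.2 : ℝ) : ℂ) * Complex.I)),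
    integral_prod_mul (fun x : ℝ => Complex.exp (((b * x : ℝ) : ℂ) * Complex.I))
      (fun x : ℝ => Complex.exp ((((b * β + c) * x : ℝ) : ℂ) * Complex.I)),
    integral_exp_gaussianReal, integral_exp_gaussianReal, integral_exp_gaussianReal,
    ← Complex.exp_add, ← Complex.exp_add]
  congr 1
  push_cast
  ring

section
variable {Ω : Type*} [MeasurableSpace Ω] {μ : Measure Ω} [IsProbabilityMeasure μ]
  {κ : ℝ → ℝ} {S : ℝ × ℝ → ℝ} {W : ℝ × ℝ → Ω → ℝ}

/-- The conditional variance of `Z_t` given `W_x`. -/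
def condVar (κ : ℝ → ℝ) (S : ℝ × ℝ → ℝ) (v : ℝ) : ℝ :=
  rayVar κ S v - rayCov κ S v ^ 2 / spectralMoment κ S 2 0

/-- The regression coefficient of `Z_t` on `W_x`. -/
def regrCoeff (κ : ℝ → ℝ) (S : ℝ × ℝ → ℝ) (v : ℝ) : ℝ :=
  rayCov κ S v / spectralMoment κ S 2 0

lemma IsGaussianSea.condVar_pos (hκ : IsDispersionLaw κ) (hS : IsSpectralDensity S)
    (hS_pos : 0 < spectralMoment κ S 0 0) (hW : IsGaussianSea μ κ S W) (v : ℝ) :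
    0 < condVar κ S v := by
  have h := hW.rayCov_sq_lt hκ hS hS_pos v
  have h0 := hW.moment20_pos hκ hS hS_pos
  unfold condVar
  rw [sub_pos, div_lt_iff₀ h0]
  linarith

/-- The density of `(Z(0), Z_t(0), W_x(0, 0))`. -/
def seaDensity (κ : ℝ → ℝ) (S : ℝ × ℝ → ℝ) (v : ℝ) : ℝ × ℝ × ℝ → ℝ :=
  shearDensity (spectralMoment κ S 0 0).toNNReal (condVar κ S v).toNNReal
    (spectralMoment κ S 2 0).toNNReal (regrCoeff κ S v)

/-- The characteristic functions of the finite-step triples converge to that of the true triple, by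
almost sure convergence, and also to the Gaussian one given by the limiting variances. The two
limits agree, and a law is determined by its characteristic function. -/
lemma IsGaussianSea.isJointDensity (hκ : IsDispersionLaw κ) (hS : IsSpectralDensity S)
    (hS_pos : 0 < spectralMoment κ S 0 0) (hW : IsGaussianSea μ κ S W) (v : ℝ) :
    IsJointDensity μ W v (seaDensity κ S v) := by
  have p0 := hW.moment20_pos hκ hS hS_pos
  have p1 := hW.condVar_pos hκ hS hS_pos v
  have n0 := (Real.toNNReal_pos.2 hS_pos).ne'
  have n1 := (Real.toNNReal_pos.2 p1).ne'
  have n2 := (Real.toNNReal_pos.2 p0).ne'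
  refine ⟨continuous_shearDensity .., shearDensity_nonneg _ _ _ _, ?_⟩
  have hfin : IsFiniteMeasure (volume.withDensity
      fun q => ENNReal.ofReal (seaDensity κ S v q)) := by
    unfold seaDensity
    rw [withDensity_shearDensity_eq_map n0 n1 n2]
    infer_instance
  have hs := hW.aemeasurable_slope v 0
  have hlim := hW.ae_tendsto_triple v 0
  rw [mul_zero] at hs hlim
  refine map_triple_eq (hW.aemeasurable _) (hW.aemeasurable_encounteredDeriv v 0) hs
    fun a b c => ?_
  unfold seaDensity
  rw [integral_exp_shearDensity n0 n1 n2]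
  have h1 := tendsto_integral_exp_mul_I (μ := μ)
    (X := fun n o => a * midValue (W · o) v (dyadicStep n) 0
      + b * rayQuotient (W · o) v (dyadicStep n) 0 + c * slopeQuotient (W · o) v (dyadicStep n) 0)
    (Y := fun o => a * encountered W v 0 o + b * encounteredDeriv W v 0 o + c * slope W 0 0 o)
    (fun n => (((hW.aemeasurable_midValue v _ 0).const_mul a).add
      ((hW.aemeasurable_rayQuotient v _ 0).const_mul b)).add
      ((hW.aemeasurable_slopeQuotient v _ 0).const_mul c))
    (by
      filter_upwards [hlim] with o ho
      exact ((ho.1.const_mul a).add (ho.2.1.const_mul b)).add (ho.2.2.const_mul c))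
  simp only [hW.integral_exp_triple hκ hS] at h1
  have h2 := hW.tendsto_tripleVar hκ hS v a b c
  rw [hW.integral_limitIntegrand hκ hS] at h2
  have hcont : Continuous fun x : ℝ => Complex.exp (-(x : ℂ) / 2) := by fun_prop
  refine (tendsto_nhds_unique h1 ((hcont.tendsto _).comp h2)).trans ?_
  simp only [Real.coe_toNNReal _ hS_pos.le, Real.coe_toNNReal _ p1.le, Real.coe_toNNReal _ p0.le]
  -- What remains is completing the square in `(b, c)`: the quadratic form equals `b ^ 2 * condVar +
  -- (b * β + c) ^ 2 * λ₂₀`.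
  congr 4
  unfold condVar regrCoeff
  field_simp
  ring

/-- The Rice type integral as an expectation, and its closed form. -/
lemma IsGaussianSea.lintegral_rice (hκ : IsDispersionLaw κ) (hS : IsSpectralDensity S)
    (hS_pos : 0 < spectralMoment κ S 0 0) (hW : IsGaussianSea μ κ S W) (v : ℝ) {E : Set ℝ}
    (hE : MeasurableSet E) :
    ∫⁻ o, ENNReal.ofReal (encounteredDeriv W v 0 o * levelDensity κ S) *
        E.indicator 1 (slope W 0 0 o) ∂μ =
      ENNReal.ofReal (levelDensity κ S) * ∫⁻ y in E,
        ENNReal.ofReal (posPartMean √(condVar κ S v) (regrCoeff κ S v * y)) *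
          gaussianPDF 0 (spectralMoment κ S 2 0).toNNReal y := by
  have hd := hW.isJointDensity hκ hS hS_pos v
  have p1 := hW.condVar_pos hκ hS hS_pos v
  have hL := (levelDensity_pos hS_pos).le
  have n0 := (Real.toNNReal_pos.2 hS_pos).ne'
  have hs := hW.aemeasurable_slope v 0
  rw [mul_zero] at hs
  have hm : AEMeasurable (fun o => (encountered W v 0 o, encounteredDeriv W v 0 o, slope W 0 0 o))
      μ := (hW.aemeasurable _).prodMk ((hW.aemeasurable_encounteredDeriv v 0).prodMk hs)
  let g : ℝ × ℝ × ℝ → ℝ≥0∞ := fun q =>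
    ENNReal.ofReal (q.2.1 * levelDensity κ S) * E.indicator 1 q.2.2
  have hg : Measurable g := by
    refine Measurable.mul (by fun_prop) ?_
    exact (measurable_one.indicator hE).comp (by fun_prop)
  calc _ = ∫⁻ q, g q ∂(μ.map fun o =>
        (encountered W v 0 o, encounteredDeriv W v 0 o, slope W 0 0 o)) :=
        (lintegral_map' hg.aemeasurable hm).symm
    _ = ∫⁻ x, gaussianPDF 0 (spectralMoment κ S 0 0).toNNReal x *
        (ENNReal.ofReal (levelDensity κ S) * ∫⁻ y in E,
        ENNReal.ofReal (posPartMean √(condVar κ S v) (regrCoeff κ S v * y)) *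
          gaussianPDF 0 (spectralMoment κ S 2 0).toNNReal y) := by
        rw [hd.map_eq]
        unfold seaDensity
        rw [lintegral_withDensity_shearDensity _ _ _ _ hg]
        refine lintegral_congr fun x => ?_
        congr 1
        rw [← lintegral_const_mul' _ _ ENNReal.ofReal_ne_top, ← lintegral_indicator hE]
        refine lintegral_congr fun y => ?_
        by_cases hy : y ∈ E
        · rw [indicator_of_mem hy, ← lintegral_mul_gaussianPDF (Real.sqrt_pos.2 p1)
            (V := (condVar κ S v).toNNReal)
            (by rw [Real.sq_sqrt p1.le, Real.coe_toNNReal _ p1.le]), ← mul_assoc, mul_comm,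
            ← lintegral_const_mul' _ _ ENNReal.ofReal_ne_top]
          congr 1
          refine lintegral_congr fun z => ?_
          simp only [g, indicator_of_mem hy, Pi.one_apply, mul_one]
          rw [ENNReal.ofReal_mul' hL]
          ring
        · simp [g, indicator_of_notMem hy]
    _ = _ := by
        rw [lintegral_mul_const _ (measurable_gaussianPDF _ _), lintegral_gaussianPDF_eq_one 0 n0,
          one_mul]

end

lemma slopePrimitive_nonneg {l τ : ℝ} (hl : 0 < l) (hτ : 0 < τ) (β w : ℝ) :
    0 ≤ slopePrimitive l τ β w := by
  have hm : Monotone (slopePrimitive l τ β) :=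
    monotone_of_hasDerivAt_nonneg
      (hasDerivAt_slopePrimitive hl hτ β (V := ⟨l ^ 2, sq_nonneg l⟩) rfl)
      fun y => mul_nonneg (Real.sqrt_nonneg _)
        (mul_nonneg (posPartMean_nonneg hτ _) (gaussianPDFReal_nonneg ..))
  exact hm.le_of_tendsto (tendsto_slopePrimitive hl hτ β) w

/-! ### The Palm distribution of the slope -/

section
variable {Ω : Type*} [MeasurableSpace Ω] {μ : Measure Ω}
  {κ : ℝ → ℝ} {S : ℝ × ℝ → ℝ} {W : ℝ × ℝ → Ω → ℝ}

/-- The intensity of upcrossings of zero by the encountered sea with slope in `E`. -/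
def riceIntensity (μ : Measure Ω) (κ : ℝ → ℝ) (S : ℝ × ℝ → ℝ) (W : ℝ × ℝ → Ω → ℝ) (v : ℝ)
    (E : Set ℝ) : ℝ≥0∞ :=
  ∫⁻ o, ENNReal.ofReal (encounteredDeriv W v 0 o * levelDensity κ S) *
    E.indicator 1 (slope W 0 0 o) ∂μ

variable [IsProbabilityMeasure μ]

lemma IsGaussianSea.lintegral_encard_slope (hκ : IsDispersionLaw κ) (hS : IsSpectralDensity S)
    (hS_pos : 0 < spectralMoment κ S 0 0) (hW : IsGaussianSea μ κ S W) (v : ℝ)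
    {J : Set ℝ} (hJ : IsOpen J) :
    AEMeasurable (fun o => ({t | t ∈ Icc (0 : ℝ) 1 ∧ encountered W v t o = 0 ∧
        0 < encounteredDeriv W v t o ∧ slope W (v * t) t o ∈ J}.encard : ℝ≥0∞)) μ ∧
      ∫⁻ o, ({t | t ∈ Icc (0 : ℝ) 1 ∧ encountered W v t o = 0 ∧
        0 < encounteredDeriv W v t o ∧ slope W (v * t) t o ∈ J}.encard : ℝ≥0∞) ∂μ =
      riceIntensity μ κ S W v J := by
  have h := hW.lintegral_encard hκ hS hS_pos v (U := {q : ℝ × ℝ | 0 < q.1 ∧ q.2 ∈ J})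
    ((isOpen_lt continuous_const continuous_fst).inter (hJ.preimage continuous_snd))
    (fun q hq => hq.1)
  have hset : ∀ o, {t | (t ∈ Icc (0 : ℝ) 1 ∧ encountered W v t o = 0) ∧
      (encounteredDeriv W v t o, slope W (v * t) t o) ∈ {q : ℝ × ℝ | 0 < q.1 ∧ q.2 ∈ J}} =
      {t | t ∈ Icc (0 : ℝ) 1 ∧ encountered W v t o = 0 ∧
        0 < encounteredDeriv W v t o ∧ slope W (v * t) t o ∈ J} := fun o => by
    ext t
    exact and_assoc
  simp only [hset, mul_zero] at h
  refine ⟨h.1, h.2.trans (lintegral_congr fun o => ?_)⟩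
  by_cases hpos : 0 < encounteredDeriv W v 0 o
  · congr 1
    exact indicator_eq_indicator (and_iff_right hpos) rfl
  · rw [ENNReal.ofReal_of_nonpos (mul_nonpos_of_nonpos_of_nonneg (not_lt.1 hpos)
      (levelDensity_pos hS_pos).le), zero_mul, zero_mul]

lemma IsGaussianSea.riceIntensity_eq (hκ : IsDispersionLaw κ) (hS : IsSpectralDensity S)
    (hS_pos : 0 < spectralMoment κ S 0 0) (hW : IsGaussianSea μ κ S W) (v : ℝ) {E : Set ℝ}
    (hE : MeasurableSet E) :
    riceIntensity μ κ S W v E =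
      ENNReal.ofReal (levelDensity κ S) * ∫⁻ y in E,
        ENNReal.ofReal (posPartMean √(condVar κ S v) (regrCoeff κ S v * y)) *
          gaussianPDF 0 (spectralMoment κ S 2 0).toNNReal y :=
  hW.lintegral_rice hκ hS hS_pos v hE

lemma IsGaussianSea.riceIntensity_Iic (hκ : IsDispersionLaw κ) (hS : IsSpectralDensity S)
    (hS_pos : 0 < spectralMoment κ S 0 0) (hW : IsGaussianSea μ κ S W) (v w : ℝ) :
    riceIntensity μ κ S W v (Iic w) =
      ENNReal.ofReal (levelDensity κ S * ((√(2 * Real.pi))⁻¹ *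
        slopePrimitive √(spectralMoment κ S 2 0) √(condVar κ S v) (regrCoeff κ S v) w)) := by
  have p0 := hW.moment20_pos hκ hS hS_pos
  have p1 := hW.condVar_pos hκ hS hS_pos v
  rw [hW.riceIntensity_eq hκ hS hS_pos v measurableSet_Iic,
    lintegral_posPartMean_Iic (Real.sqrt_pos.2 p0) (Real.sqrt_pos.2 p1) _
      (by rw [Real.sq_sqrt p0.le, Real.coe_toNNReal _ p0.le]),
    ENNReal.ofReal_mul (levelDensity_pos hS_pos).le]

lemma IsGaussianSea.riceIntensity_Iio (hκ : IsDispersionLaw κ) (hS : IsSpectralDensity S)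
    (hS_pos : 0 < spectralMoment κ S 0 0) (hW : IsGaussianSea μ κ S W) (v w : ℝ) :
    riceIntensity μ κ S W v (Iio w) = riceIntensity μ κ S W v (Iic w) := by
  rw [hW.riceIntensity_eq hκ hS hS_pos v measurableSet_Iio,
    hW.riceIntensity_eq hκ hS hS_pos v measurableSet_Iic, restrict_Iio_eq_restrict_Iic]

lemma IsGaussianSea.expectedOvertakings_eq (hκ : IsDispersionLaw κ) (hS : IsSpectralDensity S)
    (hS_pos : 0 < spectralMoment κ S 0 0) (hW : IsGaussianSea μ κ S W) (v : ℝ) :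
    expectedOvertakings μ W v = riceIntensity μ κ S W v (Iio 0) :=
  (hW.lintegral_encard_slope hκ hS hS_pos v isOpen_Iio).2

/-- Rice's formula is available for open sets of marks, while `y ≤ w` is a closed condition. For `w
< 0` the formula is applied to the open sets `y < 0` and `w < y < 0`, and the difference is taken,
which is legitimate because the intensities are finite. -/
lemma IsGaussianSea.expectedOvertakingsLE_eq (hκ : IsDispersionLaw κ) (hS : IsSpectralDensity S)
    (hS_pos : 0 < spectralMoment κ S 0 0) (hW : IsGaussianSea μ κ S W) (v w : ℝ) :
    expectedOvertakingsLE μ W v w = riceIntensity μ κ S W v {y | y < 0 ∧ y ≤ w} := by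
  rcases le_or_gt 0 w with hw | hw
  · have hE : {y : ℝ | y < 0 ∧ y ≤ w} = Iio 0 := by
      ext y
      exact ⟨fun h => h.1, fun h => ⟨h, (le_of_lt h).trans hw⟩⟩
    rw [hE, ← hW.expectedOvertakings_eq hκ hS hS_pos]
    refine lintegral_congr fun o => ?_
    congr 2
    ext t
    exact ⟨fun h => h.1, fun h => ⟨h, h.2.2.2.le.trans hw⟩⟩
  · have hE : {y : ℝ | y < 0 ∧ y ≤ w} = Iic w := by
      ext y
      exact ⟨fun h => h.2, fun h => ⟨lt_of_le_of_lt h hw, h⟩⟩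
    rw [hE]
    have hIoo := hW.lintegral_encard_slope hκ hS hS_pos v (isOpen_Ioo (a := w) (b := 0))
    have hfin : riceIntensity μ κ S W v (Ioo w 0) ≠ ⊤ := by
      have h0 : riceIntensity μ κ S W v (Iic 0) ≠ ⊤ := by
        rw [hW.riceIntensity_Iic hκ hS hS_pos]; exact ENNReal.ofReal_ne_top
      refine ne_top_of_le_ne_top h0 (lintegral_mono fun o => ?_)
      gcongr
      exact fun y hy => le_of_lt hy.2
    have hsplit : riceIntensity μ κ S W v (Iio 0) =
        riceIntensity μ κ S W v (Iic w) + riceIntensity μ κ S W v (Ioo w 0) := by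
      rw [hW.riceIntensity_eq hκ hS hS_pos v measurableSet_Iio,
        hW.riceIntensity_eq hκ hS hS_pos v measurableSet_Iic,
        hW.riceIntensity_eq hκ hS hS_pos v measurableSet_Ioo, ← mul_add,
        ← lintegral_union measurableSet_Ioo, Iic_union_Ioo_eq_Iio hw]
      exact disjoint_left.2 fun y hy hy' => not_lt.2 hy hy'.1
    have hcount : expectedOvertakings μ W v =
        expectedOvertakingsLE μ W v w + riceIntensity μ κ S W v (Ioo w 0) := by
      -- Additivity of the integral needs measurability of only one summand, here the count for the
      -- open interval.
      rw [← hIoo.2, expectedOvertakingsLE, ← lintegral_add_right' _ hIoo.1]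
      refine lintegral_congr fun o => ?_
      rw [← ENat.toENNReal_add, ← encard_union_eq]
      · congr 2
        ext t
        constructor
        · intro h
          rcases le_or_gt (slope W (v * t) t o) w with hs | hs
          · exact Or.inl ⟨h, hs⟩
          · exact Or.inr ⟨h.1, h.2.1, h.2.2.1, hs, h.2.2.2⟩
        · rintro (h | h)
          · exact h.1
          · exact ⟨h.1, h.2.1, h.2.2.1, h.2.2.2.2⟩
      · exact disjoint_left.2 fun t h h' => not_lt.2 h.2 h'.2.2.2.1
    rw [hW.expectedOvertakings_eq hκ hS hS_pos, hsplit] at hcount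
    exact ((ENNReal.add_left_inj hfin).1 hcount).symm

/-- The first factor of the joint density at level zero is `levelDensity`, and integrating `z⁺`
against the conditional density of `Z_t` given slope `y` gives `posPartMean`. This is the integral
already found for the intensity. -/
lemma IsGaussianSea.lintegral_riceIntegrand (hκ : IsDispersionLaw κ) (hS : IsSpectralDensity S)
    (hS_pos : 0 < spectralMoment κ S 0 0) (hW : IsGaussianSea μ κ S W) (v : ℝ) {E : ℝ → Prop}
    (hE : MeasurableSet {y | E y}) :
    Measurable (riceIntegrand (seaDensity κ S v) E) ∧
      ∫⁻ q, ENNReal.ofReal (riceIntegrand (seaDensity κ S v) E q) =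
        riceIntensity μ κ S W v {y | E y} := by
  have p1 := hW.condVar_pos hκ hS hS_pos v
  have hL := (levelDensity_pos hS_pos).le
  have hm : Measurable (riceIntegrand (seaDensity κ S v) E) := by
    have hc := (continuous_shearDensity (spectralMoment κ S 0 0).toNNReal (condVar κ S v).toNNReal
      (spectralMoment κ S 2 0).toNNReal (regrCoeff κ S v)).measurable
    refine Measurable.mul (Measurable.mul (by fun_prop) ?_) (hc.comp (by fun_prop))
    exact Measurable.ite (hE.preimage measurable_snd) measurable_const measurable_const
  refine ⟨hm, ?_⟩
  rw [hW.riceIntensity_eq hκ hS hS_pos v hE, Measure.volume_eq_prod,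
    lintegral_prod_symm' _ hm.ennreal_ofReal, ← lintegral_const_mul' _ _ ENNReal.ofReal_ne_top,
    ← lintegral_indicator hE]
  refine lintegral_congr fun y => ?_
  by_cases hy : E y
  · rw [indicator_of_mem (show y ∈ {y | E y} from hy), ← lintegral_mul_gaussianPDF
      (Real.sqrt_pos.2 p1) (V := (condVar κ S v).toNNReal)
      (by rw [Real.sq_sqrt p1.le, Real.coe_toNNReal _ p1.le]), mul_comm (∫⁻ _, _),
      ← lintegral_const_mul' _ _ gaussianPDF_ne_top,
      ← lintegral_const_mul' _ _ ENNReal.ofReal_ne_top]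
    refine lintegral_congr fun z => ?_
    have h0 : gaussianPDFReal 0 (spectralMoment κ S 0 0).toNNReal 0 = levelDensity κ S := by
      simp [gaussianPDFReal, levelDensity, Real.coe_toNNReal _ hS_pos.le]
    simp only [riceIntegrand, hy, if_true, mul_one, seaDensity, shearDensity, h0, gaussianPDF]
    rw [ENNReal.ofReal_mul (le_max_right _ _), ENNReal.ofReal_mul hL,
      ENNReal.ofReal_mul (gaussianPDFReal_nonneg ..)]
    have hmax : ENNReal.ofReal (max z 0) = ENNReal.ofReal z := by
      rw [ENNReal.ofReal_max, ENNReal.ofReal_zero, max_eq_left zero_le]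
    rw [hmax]
    ring
  · simp [riceIntegrand, hy]

lemma riceIntegrand_nonneg {f : ℝ × ℝ × ℝ → ℝ} (hf : ∀ q, 0 ≤ f q) (E : ℝ → Prop) (q : ℝ × ℝ) :
    0 ≤ riceIntegrand f E q := by
  refine mul_nonneg (mul_nonneg (le_max_right _ _) ?_) (hf _)
  split_ifs <;> simp

lemma IsGaussianSea.riceIntegral_eq (hκ : IsDispersionLaw κ) (hS : IsSpectralDensity S)
    (hS_pos : 0 < spectralMoment κ S 0 0) (hW : IsGaussianSea μ κ S W) (v : ℝ) {E : ℝ → Prop}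
    (hE : MeasurableSet {y | E y}) :
    riceIntegral (seaDensity κ S v) E = (riceIntensity μ κ S W v {y | E y}).toReal := by
  obtain ⟨hm, h⟩ := hW.lintegral_riceIntegrand hκ hS hS_pos v hE
  have hnn : ∀ q, 0 ≤ riceIntegrand (seaDensity κ S v) E q :=
    riceIntegrand_nonneg (shearDensity_nonneg _ _ _ _) E
  rw [riceIntegral, integral_eq_lintegral_of_nonneg_ae (ae_of_all _ hnn)
    hm.aestronglyMeasurable, h]

/-- The value is half of `√(τ ^ 2 + β ^ 2 * l ^ 2) - β * l`, positive because the conditional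
variance `τ ^ 2` is. -/
lemma IsGaussianSea.slopePrimitive_zero_pos (hκ : IsDispersionLaw κ) (hS : IsSpectralDensity S)
    (hS_pos : 0 < spectralMoment κ S 0 0) (hW : IsGaussianSea μ κ S W) (v : ℝ) :
    0 < slopePrimitive √(spectralMoment κ S 2 0) √(condVar κ S v) (regrCoeff κ S v) 0 := by
  have p1 := hW.condVar_pos hκ hS hS_pos v
  rw [slopePrimitive_zero]
  refine half_pos (sub_pos.2 (Real.lt_sqrt_of_sq_lt ?_))
  rw [mul_pow, Real.sq_sqrt p1.le]
  linarith

/-- A change of parameters. With `l = √λ₂₀`, `s = √rayVar`, `τ = √condVar` and regression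
coefficient `β`, one has `s ^ 2 = τ ^ 2 + β ^ 2 * l ^ 2`, `ρ = β * l / s` and `√(λ₂₀ * (1 - ρ ^ 2))
= l * τ / s`. -/
lemma IsGaussianSea.slopePrimitive_div (hκ : IsDispersionLaw κ) (hS : IsSpectralDensity S)
    (hS_pos : 0 < spectralMoment κ S 0 0) (hW : IsGaussianSea μ κ S W) (v w : ℝ) :
    slopePrimitive √(spectralMoment κ S 2 0) √(condVar κ S v) (regrCoeff κ S v) w /
      slopePrimitive √(spectralMoment κ S 2 0) √(condVar κ S v) (regrCoeff κ S v) 0 =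
      2 / (1 - corr κ S v) *
        (stdNormalCDF (w / Real.sqrt (spectralMoment κ S 2 0 * (1 - corr κ S v ^ 2)))
          - corr κ S v * Real.exp (-w ^ 2 / (2 * spectralMoment κ S 2 0)) *
            stdNormalCDF (corr κ S v * w /
              Real.sqrt (spectralMoment κ S 2 0 * (1 - corr κ S v ^ 2)))) := by
  have p0 := hW.moment20_pos hκ hS hS_pos
  have p1 := hW.condVar_pos hκ hS hS_pos v
  have p2 := hW.rayVar_pos hκ hS hS_pos v
  have hpos := hW.slopePrimitive_zero_pos hκ hS hS_pos v
  rw [slopePrimitive_zero] at *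
  rw [slopePrimitive]
  set m := spectralMoment κ S 2 0
  set l := √m with hl
  set τ := √(condVar κ S v) with hτ
  set β := regrCoeff κ S v with hβ
  have hl0 : 0 < l := Real.sqrt_pos.2 p0
  have hτ0 : 0 < τ := Real.sqrt_pos.2 p1
  have hl2 : l ^ 2 = m := Real.sq_sqrt p0.le
  have hβm : β * m = rayCov κ S v := by rw [hβ, regrCoeff, div_mul_cancel₀ _ p0.ne']
  have hcv : condVar κ S v = rayVar κ S v - rayCov κ S v ^ 2 / m := rfl
  have hs2 : τ ^ 2 + β ^ 2 * l ^ 2 = rayVar κ S v := by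
    rw [hl2, hτ, Real.sq_sqrt p1.le, hcv, ← hβm]
    field_simp
    ring
  rw [hs2] at hpos ⊢
  set s := √(rayVar κ S v) with hs
  have hs0 : 0 < s := Real.sqrt_pos.2 p2
  have hss : s ^ 2 = rayVar κ S v := Real.sq_sqrt p2.le
  have hρ : corr κ S v = β * l / s := by
    have e : corr κ S v = rayCov κ S v / √(m * rayVar κ S v) := rfl
    rw [e, Real.sqrt_mul p0.le, ← hl, ← hs, ← hβm, ← hl2]
    field_simp
  have hden : √(m * (1 - corr κ S v ^ 2)) = l * τ / s := by
    rw [Real.sqrt_eq_iff_mul_self_eq_of_pos (by positivity), hρ, ← hl2]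
    field_simp
    linear_combination hs2 - hss
  rw [hden, hρ, ← hl2]
  have e1 : w / (l * τ / s) = s / (l * τ) * w := by field_simp
  have e2 : β * l / s * w / (l * τ / s) = β / τ * w := by field_simp
  rw [e1, e2]
  have hne : s - β * l ≠ 0 := by intro h; rw [h] at hpos; simp at hpos
  have hne' : 1 - β * l / s = (s - β * l) / s := by field_simp
  rw [hne']
  generalize s - β * l = d at hne
  field_simp

end

end EncounteredSea

end

theorem theorem6p2 {Ω : Type*} [MeasurableSpace Ω] (μ : Measure Ω) [IsProbabilityMeasure μ]
    (κ : ℝ → ℝ) (hκ : IsDispersionLaw κ)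
    (S : ℝ × ℝ → ℝ) (hS : IsSpectralDensity S) (hS_pos : 0 < spectralMoment κ S 0 0)
    (W : ℝ × ℝ → Ω → ℝ) (hW : IsGaussianSea μ κ S W) (v : ℝ) :
    -- the second order spectral moments are finite, and the covariance matrix of
    -- `(W_x, W_t)` is nonsingular, so that the closed form below is meaningful
    ((∀ i j : ℕ, i + j = 2 → IntegrableOn (momentIntegrand κ S i j) spectralDomain) ∧
      0 < spectralMoment κ S 2 0 * spectralMoment κ S 0 2 - spectralMoment κ S 1 1 ^ 2) ∧
    -- the Palm distribution is well defined
    (0 < expectedOvertakings μ W v ∧ expectedOvertakings μ W v < ⊤) ∧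
    -- the Rice type ratio
    (∃ f : ℝ × ℝ × ℝ → ℝ, IsJointDensity μ W v f ∧
      Integrable (riceIntegrand f (fun y => y < 0)) ∧
      0 < riceIntegral f (fun y => y < 0) ∧
      ∀ w : ℝ, encSlopeCDF μ W v w =
        riceIntegral f (fun y => y < 0 ∧ y ≤ w) / riceIntegral f (fun y => y < 0)) ∧
    -- the closed form
    (∀ w : ℝ, 0 ≤ w → encSlopeCDF μ W v w = 1) ∧
    (∀ w : ℝ, w < 0 → encSlopeCDF μ W v w =
      2 / (1 - corr κ S v) *
        (stdNormalCDF (w / Real.sqrt (spectralMoment κ S 2 0 * (1 - corr κ S v ^ 2)))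
          - corr κ S v * Real.exp (-w ^ 2 / (2 * spectralMoment κ S 2 0)) *
            stdNormalCDF (corr κ S v * w /
              Real.sqrt (spectralMoment κ S 2 0 * (1 - corr κ S v ^ 2))))) := by
  have hE : ∀ w : ℝ, MeasurableSet {y : ℝ | y < 0 ∧ y ≤ w} := fun w =>
    measurableSet_Iio.inter measurableSet_Iic
  -- This factor is common to numerator and denominator and cancels in the closed form.
  have hc : 0 < levelDensity κ S * (√(2 * Real.pi))⁻¹ :=
    mul_pos (levelDensity_pos hS_pos) (by positivity)
  have hpos := hW.slopePrimitive_zero_pos hκ hS hS_pos v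
  have hN := hW.expectedOvertakings_eq hκ hS hS_pos v
  have hI0 := hW.riceIntensity_Iic hκ hS hS_pos v 0
  rw [← hW.riceIntensity_Iio hκ hS hS_pos, ← mul_assoc] at hI0
  have hNpos : 0 < expectedOvertakings μ W v := by
    rw [hN, hI0]
    exact ENNReal.ofReal_pos.2 (mul_pos hc hpos)
  have hNfin : expectedOvertakings μ W v < ⊤ := by
    rw [hN, hI0]
    exact ENNReal.ofReal_lt_top
  have hden := hW.riceIntegral_eq hκ hS hS_pos v (E := fun y => y < 0) measurableSet_Iio
  have hcdf : ∀ w, encSlopeCDF μ W v w =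
      (riceIntensity μ κ S W v {y | y < 0 ∧ y ≤ w}).toReal /
        (riceIntensity μ κ S W v (Iio 0)).toReal := fun w => by
    rw [encSlopeCDF, hN, hW.expectedOvertakingsLE_eq hκ hS hS_pos, ENNReal.toReal_div]
  refine ⟨⟨hW.integrableOn_momentIntegrand hκ hS, ?_⟩, ⟨hNpos, hNfin⟩,
    ⟨seaDensity κ S v, hW.isJointDensity hκ hS hS_pos v, ?_, ?_, fun w => ?_⟩, fun w hw => ?_,
    fun w hw => ?_⟩
  -- For velocity `0`, `rayVar` is `λ₀₂` and `rayCov` is `λ₁₁`.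
  · have h := hW.rayCov_sq_lt hκ hS hS_pos 0
    simp only [rayCov, rayVar, zero_mul, mul_zero, zero_add, zero_pow two_ne_zero] at h
    linarith
  · obtain ⟨hm, h⟩ := hW.lintegral_riceIntegrand hκ hS hS_pos v (E := fun y => y < 0)
      measurableSet_Iio
    refine ⟨hm.aestronglyMeasurable, ?_⟩
    rw [hasFiniteIntegral_iff_ofReal (ae_of_all _
      (riceIntegrand_nonneg (hW.isJointDensity hκ hS hS_pos v).nonneg _)), h]
    exact hN ▸ hNfin
  · rw [hden]
    exact ENNReal.toReal_pos (hN ▸ hNpos).ne' (hN ▸ hNfin).ne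
  · rw [hcdf, hden, hW.riceIntegral_eq hκ hS hS_pos v (hE w)]
    rfl
  · have hset : {y : ℝ | y < 0 ∧ y ≤ w} = Iio 0 := by
      ext y
      exact ⟨fun h => h.1, fun h => ⟨h, (le_of_lt h).trans hw⟩⟩
    rw [hcdf, hset]
    exact div_self (ENNReal.toReal_pos (hN ▸ hNpos).ne' (hN ▸ hNfin).ne).ne'
  · have hset : {y : ℝ | y < 0 ∧ y ≤ w} = Iic w := by
      ext y
      exact ⟨fun h => h.2, fun h => ⟨lt_of_le_of_lt h hw, h⟩⟩
    have hIw := hW.riceIntensity_Iic hκ hS hS_pos v w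
    rw [← mul_assoc] at hIw
    have hnn : 0 ≤ slopePrimitive √(spectralMoment κ S 2 0) √(condVar κ S v)
        (regrCoeff κ S v) w :=
      slopePrimitive_nonneg (Real.sqrt_pos.2 (hW.moment20_pos hκ hS hS_pos))
        (Real.sqrt_pos.2 (hW.condVar_pos hκ hS hS_pos v)) _ w
    rw [hcdf, hset, hI0, hIw, ENNReal.toReal_ofReal (mul_nonneg hc.le hnn),
      ENNReal.toReal_ofReal (mul_nonneg hc.le hpos.le), mul_div_mul_left _ _ hc.ne',
      hW.slopePrimitive_div hκ hS hS_pos]
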